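/- Let $d\ge 1$, let $D\subset\mathbb{R}^d$ be a bounded domain (nonempty, open, connected) and let $T>0$. Write $\delta(x,\partial D)$ for the Euclidean distance to the boundary. Let $u$ be a solution on $[0,T]$ of the initial-boundary value problem $$\partial_t u=\Delta_x u \ \text{ in } (0,T)\times D,\qquad u=f \ \text{ on } [0,T]\times\partial D,\qquad u(0,\cdot)=f_0 \ \text{ on } D,$$ that is, $u$ is of class $\mathcal{C}^{1,2}$ on $(0,T)\times D$, continuous on $[0,T]\times\overline{D}$, and satisfies these three relations (such a solution is unique). Put $\alpha(t,x)=\min\big(t,\tfrac{e}{2d}\,\delta(x,\partial D)^2\big)$ and $\psi_d(s)=\sqrt{s\log(s^{-d/2})}$. Let $(U_n)_{n\ge1}$, $(G_n)_{n\ge1}$, $(V_n)_{n\ge1}$ be mutually independent random variables, with $U_n$ uniform on $[0,1]^{\lfloor d/2\rfloor+1}$, $G_n$ standard Gaussian and $V_n$ uniform on the unit sphere of $\mathbb{R}^d$; let $\Pi_n$ be the product of the coordinates of $U_n$ and $$R_n=\Pi_n^{2/d}\exp\Big\{-\Big(1-\frac2d\Big\lfloor\frac d2\Big\rfloor\Big)G_n^2\Big\}.$$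 For a starting point $(T_0,X_0)=(t,x)\in[0,T]\times\overline{D}$ define the random walk $$T_{n+1}=T_n-\alpha(T_n,X_n)R_{n+1},\qquad X_{n+1}=X_n+2\sqrt{\alpha(T_n,X_n)}\,\psi_d(R_{n+1})V_{n+1}.$$ For $\varepsilon>0$ let $\mathcal{N}_\varepsilon=\inf\{n\ge0:\alpha(T_n,X_n)\le\varepsilon\}$. If $\delta(X_{\mathcal{N}_\varepsilon},\partial D)^2\le 2\varepsilon d/e$, let $X_\varepsilon$ be a (measurably chosen) point of $\partial D$ nearest to $X_{\mathcal{N}_\varepsilon}$ and $T_\varepsilon=T_{\mathcal{N}_\varepsilon}$; otherwise let $X_\varepsilon=X_{\mathcal{N}_\varepsilon}$ and $T_\varepsilon=0$. Put $$u^\varepsilon(t,x)=\mathbb{E}_{(t,x)}\big[f(T_\varepsilon,X_\varepsilon)1_{\{X_\varepsilon\in\partial D\}}\big]+\mathbb{E}_{(t,x)}\big[f_0(X_\varepsilon)1_{\{X_\varepsilon\notin\partial D\}}\big].$$ Then $u^\varepsilon\to u$ as $\varepsilon\to0$, uniformly on $[0,T]\times\overline{D}$. Moreover, if the first derivatives $\partial_t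 u$ and $\partial_x u$ are bounded on $(0,T)\times D$ (for instance, if $u$ is $\mathcal{C}^{1,2}$ up to the boundary of $[0,T]\times D$), then there exist $\kappa_{T,D}(u)>0$ and $\varepsilon_0>0$, not depending on the choice of the random variables, such that $$|u(t,x)-u^\varepsilon(t,x)|\le\kappa_{T,D}(u)\sqrt{\varepsilon}\qquad\text{for all } 0<\varepsilon\le\varepsilon_0,\ (t,x)\in[0,T]\times\overline{D}.$$ -/

import Mathlib

open MeasureTheory ProbabilityTheory Set Filter Topology

universe v

noncomputable section

namespace HeatWalk

/-- The space `ℝ^d` with its Euclidean norm. -/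
abbrev Space (d : ℕ) : Type := EuclideanSpace ℝ (Fin d)

/-! ### The initial-boundary value problem -/

/-- `u` is of class `C^{1,2}` on `(0,T) × D`: the derivatives `∂_t u`, `∂_x u`, `∂_x² u` exist and
are jointly continuous there. -/
structure IsC12 {d : ℕ} (D : Set (Space d)) (T : ℝ) (u : ℝ → Space d → ℝ) : Prop where
  differentiable_time : ∀ t ∈ Ioo 0 T, ∀ x ∈ D, DifferentiableAt ℝ (fun s => u s x) t
  contDiff_space : ∀ t ∈ Ioo 0 T, ContDiffOn ℝ 2 (u t) D
  continuous_deriv_time :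
    ContinuousOn (fun p : ℝ × Space d => deriv (fun s => u s p.2) p.1) (Ioo 0 T ×ˢ D)
  continuous_deriv_space :
    ContinuousOn (fun p : ℝ × Space d => fderiv ℝ (u p.1) p.2) (Ioo 0 T ×ˢ D)
  continuous_deriv_space_two :
    ContinuousOn (fun p : ℝ × Space d => iteratedFDeriv ℝ 2 (u p.1) p.2) (Ioo 0 T ×ˢ D)

/-- `u` solves `∂_t u = Δ_x u` in `D` up to time `T`, with boundary values `f` on `[0,T] × ∂D` and
initial values `f₀` on `D`: it is `C^{1,2}` inside and continuous on `[0,T] × closure D`.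
(Hence `f` and `f₀` are automatically continuous and compatible.) -/
structure IsSolution {d : ℕ} (D : Set (Space d)) (T : ℝ)
    (f : ℝ → Space d → ℝ) (f₀ : Space d → ℝ) (u : ℝ → Space d → ℝ) : Prop where
  isC12 : IsC12 D T u
  continuous_closure :
    ContinuousOn (fun p : ℝ × Space d => u p.1 p.2) (Icc 0 T ×ˢ closure D)
  heat : ∀ t ∈ Ioo 0 T, ∀ x ∈ D, deriv (fun s => u s x) t = Laplacian.laplacian (u t) x
  boundary : ∀ t ∈ Icc 0 T, ∀ x ∈ frontier D, u t x = f t x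
  initial : ∀ x ∈ D, u 0 x = f₀ x

/-- The first derivatives `∂_t u` and `∂_x u` are bounded on `(0,T) × D`. -/
def BoundedFirstDerivatives {d : ℕ} (D : Set (Space d)) (T : ℝ) (u : ℝ → Space d → ℝ) : Prop :=
  ∃ K : ℝ, ∀ t ∈ Ioo 0 T, ∀ x ∈ D,
    |deriv (fun s => u s x) t| ≤ K ∧ ‖fderiv ℝ (u t) x‖ ≤ K

/-! ### The random walk on heat balls -/

/-- Euclidean distance `δ(x, ∂D)`. -/
def bdist {d : ℕ} (D : Set (Space d)) (x : Space d) : ℝ := Metric.infDist x (frontier D)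

/-- `α(t,x) = min (t, e/(2d) δ(x,∂D)²)`. -/
def alpha {d : ℕ} (D : Set (Space d)) (p : ℝ × Space d) : ℝ :=
  min p.1 (Real.exp 1 / (2 * d) * bdist D p.2 ^ 2)

/-- `ψ_d(s) = √(s log(s^{-d/2}))`. -/
def psi (d : ℕ) (s : ℝ) : ℝ := Real.sqrt (s * Real.log (s ^ (-(d / 2 : ℝ))))

/-- `R = (∏ᵢ Uᵢ)^{2/d} exp(-(1 - (2/d)⌊d/2⌋) G²)`; here `d / 2` in `ℕ` is `⌊d/2⌋`. -/
def radial (d : ℕ) (U : Fin (d / 2 + 1) → ℝ) (G : ℝ) : ℝ :=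
  (∏ i, U i) ^ (2 / d : ℝ) * Real.exp (-(1 - 2 / d * ((d / 2 : ℕ) : ℝ)) * G ^ 2)

/-- The path `(T_n, X_n)` started at `p`, driven by the numbers `R_{n+1} = R n` and the directions
`V_{n+1} = V n`. -/
def path {d : ℕ} (D : Set (Space d)) (R : ℕ → ℝ) (V : ℕ → Space d) (p : ℝ × Space d) :
    ℕ → ℝ × Space d
  | 0 => p
  | n + 1 =>
    let M := path D R V p n
    (M.1 - alpha D M * R n, M.2 + (2 * Real.sqrt (alpha D M) * psi d (R n)) • V n)

/-- The uniform probability measure on the unit sphere of `ℝ^d`. -/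
def uniformSphere (d : ℕ) : Measure (Metric.sphere (0 : Space d) 1) :=
  ((volume : Measure (Space d)).toSphere univ)⁻¹ • (volume : Measure (Space d)).toSphere

/-- `U n`, `G n`, `V n` (`n = 0, 1, …`, standing for the variables of index `n + 1`) are random
variables, uniform on `[0,1]^{⌊d/2⌋+1}`, standard Gaussian, and uniform on the unit sphere,
respectively, and all of them are mutually independent. -/
structure IsNoise {Ω : Type v} [MeasurableSpace Ω] (P : Measure Ω) {d : ℕ}
    (U : ℕ → Ω → Fin (d / 2 + 1) → ℝ) (G : ℕ → Ω → ℝ)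
    (V : ℕ → Ω → Metric.sphere (0 : Space d) 1) : Prop where
  measurable_U : ∀ n, Measurable (U n)
  measurable_G : ∀ n, Measurable (G n)
  measurable_V : ∀ n, Measurable (V n)
  law_U : ∀ n, P.map (U n) = volume.restrict (Icc 0 1)
  law_G : ∀ n, P.map (G n) = gaussianReal 0 1
  law_V : ∀ n, P.map (V n) = uniformSphere d
  indep_steps : iIndepFun (fun n ω => (U n ω, G n ω, V n ω)) P
  indep_U_GV : ∀ n, IndepFun (U n) (fun ω => (G n ω, V n ω)) P
  indep_G_V : ∀ n, IndepFun (G n) (V n) P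

section Walk

variable {Ω : Type v} {d : ℕ} (D : Set (Space d))
  (U : ℕ → Ω → Fin (d / 2 + 1) → ℝ) (G : ℕ → Ω → ℝ) (V : ℕ → Ω → Metric.sphere (0 : Space d) 1)

/-- The random walk `(T_n, X_n)` started at `(t,x)`. -/
def walk (t : ℝ) (x : Space d) (n : ℕ) (ω : Ω) : ℝ × Space d :=
  path D (fun k => radial d (U k ω) (G k ω)) (fun k => (V k ω : Space d)) (t, x) n

/-- `N_ε = inf {n : α(T_n, X_n) ≤ ε}` (almost surely finite). -/
def stopIndex (ε t : ℝ) (x : Space d) (ω : Ω) : ℕ :=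
  sInf {n : ℕ | alpha D (walk D U G V t x n ω) ≤ ε}

/-- The stopped walk `(T_{N_ε}, X_{N_ε})`. -/
def stopped (ε t : ℝ) (x : Space d) (ω : Ω) : ℝ × Space d :=
  walk D U G V t x (stopIndex D U G V ε t x ω) ω

/-- The stop happens close to the boundary: `δ(X_{N_ε}, ∂D)² ≤ 2εd/e`. -/
def StopsNearBoundary (ε t : ℝ) (x : Space d) (ω : Ω) : Prop :=
  bdist D (stopped D U G V ε t x ω).2 ^ 2 ≤ 2 * ε * d / Real.exp 1

open Classical in
/-- `T_ε`, which is `T_{N_ε}` if the stop happens close to the boundary, and `0` otherwise. -/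
def finalTime (ε t : ℝ) (x : Space d) (ω : Ω) : ℝ :=
  if StopsNearBoundary D U G V ε t x ω then (stopped D U G V ε t x ω).1 else 0

/-- `Y ε t x` is an admissible choice of the random point `X_ε` for the walk started at `(t,x)`:
almost surely it is a point of `∂D` nearest to `X_{N_ε}` if the stop happens close to the boundary,
and `X_{N_ε}` otherwise. -/
structure IsFinalPosition [MeasurableSpace Ω] (P : Measure Ω) (T : ℝ)
    (Y : ℝ → ℝ → Space d → Ω → Space d) : Prop where
  measurable : ∀ ε > 0, ∀ t ∈ Icc 0 T, ∀ x ∈ closure D, Measurable (Y ε t x)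
  near : ∀ ε > 0, ∀ t ∈ Icc 0 T, ∀ x ∈ closure D, ∀ᵐ ω ∂P, StopsNearBoundary D U G V ε t x ω →
    Y ε t x ω ∈ frontier D ∧
      dist (stopped D U G V ε t x ω).2 (Y ε t x ω) = bdist D (stopped D U G V ε t x ω).2
  far : ∀ ε > 0, ∀ t ∈ Icc 0 T, ∀ x ∈ closure D, ∀ᵐ ω ∂P, ¬ StopsNearBoundary D U G V ε t x ω →
    Y ε t x ω = (stopped D U G V ε t x ω).2

/-- `u^ε(t,x) = E[f(T_ε, X_ε) 1_{X_ε ∈ ∂D}] + E[f₀(X_ε) 1_{X_ε ∉ ∂D}]`, with `X_ε = Y ε t x`. -/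
def approx [MeasurableSpace Ω] (P : Measure Ω) (Y : ℝ → ℝ → Space d → Ω → Space d)
    (f : ℝ → Space d → ℝ) (f₀ : Space d → ℝ) (ε t : ℝ) (x : Space d) : ℝ :=
  (∫ ω, (frontier D).indicator (f (finalTime D U G V ε t x ω)) (Y ε t x ω) ∂P) +
    ∫ ω, (frontier D)ᶜ.indicator f₀ (Y ε t x ω) ∂P

end Walk

end HeatWalk

end

/-!
The walk samples the heat equation on heat balls. For `0 < a ≤ α(t,x)` the heat ball of size `a` at
`(t,x)`, the set of the points `(t - a s, x + √a y)` with `0 < s < 1` and `|y| < 2 ψ_d(s)`, lies in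
the domain, and a solution of the heat equation has at `(t,x)` the mean of its values over the
boundary of that ball, with respect to the law of one step of the walk. Hence the values of the
solution along the walk form a martingale, optional stopping at `N_ε` gives
`u(t,x) = E u(T_{N_ε}, X_{N_ε})` (`IsSolution.integral_stopped`), and `u^ε` differs from `u` only
because the data are read off at a point near to the one where the walk stops.

*Mean value formula* (`IsBackwardCaloric.mean_value`). Rescale the solution to a function `v` with
`∂_s v = -Δ v`, and integrate `v(s,·)` against `max (k(s,·) - 1) 0`, where `k` is the heat kernel
normalised so that the heat ball is `{k > 1}`. The truncated kernel is Lipschitz and vanishes on the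
boundary of the heat ball, so one may differentiate in `s` under the integral sign and integrate by
parts once without boundary terms. In polar coordinates what is left is a derivative along each ray,
whence the derivative in `s` is minus the integral of `v` over the sphere of radius `2 ψ_d(s)`, with
the weight `heatWeight d s` (`hasDerivAt_heatIntegral'`). The integral tends to a multiple of
`v(0,0)` as `s → 0`, by scaling, and to `0` as `s → 1`. The constants need not be computed, since
`v = 1` has the same ones.

*Law of the radial variable* (`integral_radial_mul_integral_heatWeight`). The variable `R` has the
density `heatWeight d` up to a constant: both laws live on `[0,1]` and have the same moments, so
that Weierstrass' theorem identifies them.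

*Stopping* (`IsNoise.ae_exists_alpha_le`). As long as the walk goes on, each step uses up time at
least `ε R_{n+1}`, while the sum of the independent variables `R_n` is almost surely infinite. The
martingale property is used only through the constancy of expectations along the walk frozen at
`N_ε` (`IsSolution.integral_stoppedPath`), which follows from Fubini's theorem, the frozen walk at
index `n` being independent of the noise of the next step; bounded convergence does the rest.

*Error* (`IsSolution.abs_sub_approx_le`). If the walk stops close to the boundary, the position
moves by at most `√(2 d ε / e)`; otherwise the time moves from at most `ε` to `0`. Uniform continuity of
`u` on the compact set `[0,T] × closure D` gives uniform convergence, and bounds on the first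
derivatives give the rate `√ε`.
-/

noncomputable section

namespace HeatWalk

/-! ### The law of the radial variable -/

/-- Two finite measures carried by `[0,1]` with the same moments integrate continuous functions
alike; this is Weierstrass' approximation theorem. -/
theorem integral_eq_of_moments_eq {μ ν : Measure ℝ} [IsFiniteMeasure μ] [IsFiniteMeasure ν]
    (hμ : ∀ᵐ x ∂μ, x ∈ Icc (0 : ℝ) 1) (hν : ∀ᵐ x ∂ν, x ∈ Icc (0 : ℝ) 1)
    (h : ∀ k : ℕ, ∫ x, x ^ k ∂μ = ∫ x, x ^ k ∂ν) {g : ℝ → ℝ} (hg : ContinuousOn g (Icc 0 1)) :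
    ∫ x, g x ∂μ = ∫ x, g x ∂ν := by
  have hint : ∀ (ρ : Measure ℝ) [IsFiniteMeasure ρ], (∀ᵐ x ∂ρ, x ∈ Icc (0 : ℝ) 1) →
      ∀ f : ℝ → ℝ, ContinuousOn f (Icc 0 1) → Integrable f ρ := by
    intro ρ _ hρ f hf
    have := hf.integrableOn_compact (μ := ρ) isCompact_Icc
    rwa [IntegrableOn, Measure.restrict_eq_self_of_ae_mem hρ] at this
  have hpoly : ∀ p : Polynomial ℝ, ∫ x, p.eval x ∂μ = ∫ x, p.eval x ∂ν := by
    intro p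
    simp only [Polynomial.eval_eq_sum_range]
    rw [integral_finsetSum, integral_finsetSum]
    · refine Finset.sum_congr rfl fun k _ => ?_
      rw [integral_const_mul, integral_const_mul, h k]
    · intro k _
      exact hint ν hν _ (by fun_prop)
    · intro k _
      exact hint μ hμ _ (by fun_prop)
  -- a polynomial uniformly close to `g` has close integrals for both measures
  have key : ∀ ε > 0, |∫ x, g x ∂μ - ∫ x, g x ∂ν| ≤ ε * (μ.real univ + ν.real univ) := by
    intro ε hε
    obtain ⟨p, hp⟩ := exists_polynomial_near_of_continuousOn 0 1 g hg ε hε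
    have hb : ∀ (ρ : Measure ℝ) [IsFiniteMeasure ρ], (∀ᵐ x ∂ρ, x ∈ Icc (0 : ℝ) 1) →
        |∫ x, g x ∂ρ - ∫ x, p.eval x ∂ρ| ≤ ε * ρ.real univ := by
      intro ρ _ hρ
      rw [← integral_sub (hint ρ hρ _ hg) (hint ρ hρ _ (by fun_prop))]
      refine norm_integral_le_of_norm_le_const (μ := ρ) (f := fun x => g x - p.eval x) ?_
      filter_upwards [hρ] with x hx
      rw [Real.norm_eq_abs, abs_sub_comm]
      exact (hp x hx).le
    have h1 := hb μ hμ
    have h2 := hb ν hν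
    rw [hpoly p] at h1
    rw [abs_le] at *
    constructor <;> linarith [h1.1, h1.2, h2.1, h2.2]
  rw [← sub_eq_zero, ← abs_eq_zero]
  refine le_antisymm (le_of_forall_pos_le_add fun ε hε => ?_) (abs_nonneg _)
  have hM : 0 ≤ μ.real univ + ν.real univ := by positivity
  refine (key (ε / (μ.real univ + ν.real univ + 1)) (by positivity)).trans ?_
  rw [zero_add, div_mul_eq_mul_div, div_le_iff₀ (by positivity)]
  nlinarith

theorem psi_nonneg (d : ℕ) (s : ℝ) : 0 ≤ psi d s := Real.sqrt_nonneg _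

theorem psi_sq {d : ℕ} {s : ℝ} (h0 : 0 < s) (h1 : s ≤ 1) :
    psi d s ^ 2 = d / 2 * (s * -Real.log s) := by
  have hl := Real.log_nonpos h0.le h1
  rw [psi, Real.log_rpow h0, Real.sq_sqrt]
  · ring
  · have : (0 : ℝ) ≤ d / 2 := by positivity
    have := mul_nonneg this (neg_nonneg.2 hl)
    exact mul_nonneg h0.le (by linarith)

/-- The unnormalised density on `(0,1)` of the radial variable: up to a constant it is
`s^(d/2-1) (-log s)^(d/2)`; in this form it is the weight of the sphere of radius `2 ψ_d(s)` in the
mean value formula on the unit heat ball. -/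
def heatWeight (d : ℕ) (s : ℝ) : ℝ := (2 * psi d s) ^ d / (2 * s)

theorem heatWeight_eq {d : ℕ} {s : ℝ} (h0 : 0 < s) (h1 : s ≤ 1) :
    heatWeight d s =
      (2 * d : ℝ) ^ (d / 2 : ℝ) / 2 * (s ^ (d / 2 - 1 : ℝ) * (-Real.log s) ^ (d / 2 : ℝ)) := by
  have hl := neg_nonneg.2 (Real.log_nonpos h0.le h1)
  have h2 : (0:ℝ) ≤ 2 * psi d s := mul_nonneg zero_le_two (psi_nonneg d s)
  have e : (2 * psi d s) ^ d = ((2 * psi d s) ^ 2) ^ (d / 2 : ℝ) := by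
    rw [← Real.rpow_natCast (2 * psi d s) 2, ← Real.rpow_mul h2, ← Real.rpow_natCast]
    congr 1
    push_cast
    ring
  rw [heatWeight, e, mul_pow, psi_sq h0 h1, Real.rpow_sub h0, Real.rpow_one,
    show (2 : ℝ) ^ 2 * (d / 2 * (s * -Real.log s)) = (2 * d) * (s * -Real.log s) by ring,
    Real.mul_rpow (by positivity) (mul_nonneg h0.le hl), Real.mul_rpow h0.le hl]
  field_simp

theorem image_exp_neg_Ioi : (fun x : ℝ => Real.exp (-x)) '' Ioi 0 = Ioo 0 1 := by
  ext s
  constructor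
  · rintro ⟨x, hx, rfl⟩
    exact ⟨Real.exp_pos _, by simpa using hx⟩
  · rintro ⟨h0, h1⟩
    exact ⟨-Real.log s, by simpa using Real.log_neg h0 h1, by simp [Real.exp_log h0]⟩

theorem exp_neg_smul_eq {d : ℕ} (k : ℕ) {x : ℝ} (hx : 0 < x) :
    |-Real.exp (-x)| • (heatWeight d (Real.exp (-x)) * Real.exp (-x) ^ k) =
      (2 * d : ℝ) ^ (d / 2 : ℝ) / 2 *
        (x ^ ((d / 2 + 1 : ℝ) - 1) * Real.exp (-((k + d / 2 : ℝ) * x))) := by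
  rw [heatWeight_eq (Real.exp_pos _) (by simpa using hx.le), abs_neg,
    abs_of_pos (Real.exp_pos _), Real.log_exp, neg_neg, smul_eq_mul, ← Real.exp_mul,
    ← Real.exp_nat_mul, show (d / 2 + 1 : ℝ) - 1 = d / 2 by ring,
    show -((k + d / 2 : ℝ) * x) = -x + (-x * (d / 2 - 1) + k * -x) by ring, Real.exp_add,
    Real.exp_add]
  ring

theorem hasDerivWithinAt_exp_neg (x : ℝ) (S : Set ℝ) :
    HasDerivWithinAt (fun x : ℝ => Real.exp (-x)) (-Real.exp (-x)) S x := by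
  simpa using (hasDerivAt_neg x).exp.hasDerivWithinAt

theorem injOn_exp_neg (S : Set ℝ) : InjOn (fun x : ℝ => Real.exp (-x)) S :=
  fun _ _ _ _ h => neg_injective (Real.exp_injective h)

/-- The moments of the density are Gamma integrals, by the substitution `s = exp (-x)`. -/
theorem integral_heatWeight_mul_pow {d : ℕ} (hd : 1 ≤ d) (k : ℕ) :
    ∫ s in Ioo (0 : ℝ) 1, heatWeight d s * s ^ k =
      (2 * d : ℝ) ^ (d / 2 : ℝ) / 2 *
        ((1 / (k + d / 2 : ℝ)) ^ (d / 2 + 1 : ℝ) * Real.Gamma (d / 2 + 1)) := by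
  have hd0 : (0 : ℝ) < d := by exact_mod_cast hd
  rw [← image_exp_neg_Ioi, integral_image_eq_integral_abs_deriv_smul measurableSet_Ioi
    (fun x _ => hasDerivWithinAt_exp_neg x _) (injOn_exp_neg _),
    setIntegral_congr_fun measurableSet_Ioi fun x hx => exp_neg_smul_eq k hx, integral_const_mul,
    Real.integral_rpow_mul_exp_neg_mul_Ioi (by positivity) (by positivity)]

theorem integrableOn_heatWeight {d : ℕ} (hd : 1 ≤ d) : IntegrableOn (heatWeight d) (Ioo 0 1) := by
  have hd0 : (0 : ℝ) < d := by exact_mod_cast hd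
  -- a function which is not integrable would have the integral `0`
  refine Integrable.of_integral_ne_zero ?_
  have := integral_heatWeight_mul_pow hd 0
  simp only [pow_zero, mul_one] at this
  rw [this]
  have := Real.Gamma_pos_of_pos (show (0 : ℝ) < d / 2 + 1 by positivity)
  positivity

theorem integral_heatWeight_pos {d : ℕ} (hd : 1 ≤ d) :
    0 < ∫ s in Ioo (0 : ℝ) 1, heatWeight d s := by
  have hd0 : (0 : ℝ) < d := by exact_mod_cast hd
  have := integral_heatWeight_mul_pow hd 0
  simp only [pow_zero, mul_one] at this
  rw [this]
  have := Real.Gamma_pos_of_pos (show (0 : ℝ) < d / 2 + 1 by positivity)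
  positivity

theorem heatWeight_nonneg (d : ℕ) {s : ℝ} (h0 : 0 < s) : 0 ≤ heatWeight d s := by
  have := psi_nonneg d s
  unfold heatWeight
  positivity

theorem measurable_psi (d : ℕ) : Measurable (psi d) := by
  unfold psi; fun_prop

theorem measurable_heatWeight (d : ℕ) : Measurable (heatWeight d) := by
  unfold heatWeight
  have := measurable_psi d
  fun_prop

/-- The joint law of the variables `U`, `G` entering the radial variable. -/
def radialNoise (d : ℕ) : Measure ((Fin (d / 2 + 1) → ℝ) × ℝ) :=
  (volume.restrict (Icc 0 1)).prod (gaussianReal 0 1)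

theorem restrict_Icc_eq_pi (n : ℕ) :
    (volume.restrict (Icc 0 1) : Measure (Fin n → ℝ)) =
      Measure.pi fun _ => volume.restrict (Icc (0 : ℝ) 1) := by
  rw [volume_pi, ← Measure.restrict_pi_pi, ← pi_univ_Icc]
  rfl

instance (n : ℕ) : IsProbabilityMeasure (volume.restrict (Icc 0 1) : Measure (Fin n → ℝ)) := by
  rw [restrict_Icc_eq_pi]
  have : IsProbabilityMeasure (volume.restrict (Icc (0 : ℝ) 1)) := ⟨by simp⟩
  infer_instance

instance (d : ℕ) : IsProbabilityMeasure (radialNoise d) := by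
  unfold radialNoise; infer_instance

theorem measurable_radial (d : ℕ) :
    Measurable fun p : (Fin (d / 2 + 1) → ℝ) × ℝ => radial d p.1 p.2 := by
  unfold radial
  have : Measurable fun p : (Fin (d / 2 + 1) → ℝ) × ℝ => ∏ i, p.1 i :=
    Finset.measurable_prod _ fun i _ => by fun_prop
  fun_prop

theorem gaussianExponent_nonneg (d : ℕ) : 0 ≤ 1 - 2 / (d : ℝ) * ((d / 2 : ℕ) : ℝ) := by
  rcases Nat.eq_zero_or_pos d with rfl | hd
  · simp
  have hd0 : (0 : ℝ) < d := by exact_mod_cast hd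
  rw [sub_nonneg, div_mul_eq_mul_div, div_le_one hd0]
  exact_mod_cast Nat.mul_div_le d 2

theorem radial_mem_Icc (d : ℕ) {U : Fin (d / 2 + 1) → ℝ} (hU : U ∈ Icc 0 1) (G : ℝ) :
    radial d U G ∈ Icc (0 : ℝ) 1 := by
  have h0 : 0 ≤ ∏ i, U i := Finset.prod_nonneg fun i _ => hU.1 i
  have h1 : ∏ i, U i ≤ 1 := Finset.prod_le_one (fun i _ => hU.1 i) fun i _ => hU.2 i
  have h2 := gaussianExponent_nonneg d
  refine ⟨by unfold radial; positivity, ?_⟩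
  refine mul_le_one₀ (Real.rpow_le_one h0 h1 (by positivity)) (Real.exp_pos _).le ?_
  rw [Real.exp_le_one_iff, neg_mul, neg_nonpos]
  positivity

theorem ae_radial_mem_Icc (d : ℕ) :
    ∀ᵐ p ∂radialNoise d, radial d p.1 p.2 ∈ Icc (0 : ℝ) 1 := by
  have h : ∀ᵐ U ∂(volume.restrict (Icc 0 1) : Measure (Fin (d / 2 + 1) → ℝ)), U ∈ Icc 0 1 :=
    ae_restrict_mem measurableSet_Icc
  have := (Measure.quasiMeasurePreserving_fst (μ := volume.restrict (Icc 0 1))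
    (ν := gaussianReal 0 1)).ae h
  filter_upwards [this] with p hp
  exact radial_mem_Icc d hp _

theorem integral_exp_neg_mul_sq_gaussianReal {a : ℝ} (ha : 0 ≤ a) :
    ∫ x, Real.exp (-a * x ^ 2) ∂gaussianReal 0 1 = √(1 / (1 + 2 * a)) := by
  rw [integral_gaussianReal_eq_integral_smul one_ne_zero]
  have : ∀ x : ℝ, gaussianPDFReal 0 1 x • Real.exp (-a * x ^ 2) =
      (√(2 * Real.pi))⁻¹ * Real.exp (-(1 / 2 + a) * x ^ 2) := by
    intro x
    rw [gaussianPDFReal_def, smul_eq_mul, mul_assoc, ← Real.exp_add]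
    congr 2
    · simp
    · simp; ring
  simp_rw [this]
  rw [integral_const_mul, integral_gaussian, ← Real.sqrt_inv, ← Real.sqrt_mul (by positivity)]
  congr 1
  have := Real.pi_pos
  field_simp

theorem integral_Icc_rpow {a : ℝ} (ha : 0 ≤ a) : ∫ x in Icc (0 : ℝ) 1, x ^ a = 1 / (1 + a) := by
  rw [integral_Icc_eq_integral_Ioc, ← intervalIntegral.integral_of_le zero_le_one,
    integral_rpow (Or.inl (by linarith)), Real.one_rpow, Real.zero_rpow (by positivity)]
  ring

/-- The moments of the radial variable. The Gaussian factor supplies the square root that the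
`⌊d/2⌋ + 1` uniform factors lack when `d` is odd. -/
theorem integral_radial_pow {d : ℕ} (hd : 1 ≤ d) (k : ℕ) :
    ∫ p, radial d p.1 p.2 ^ k ∂radialNoise d = (1 / (1 + 2 * k / d : ℝ)) ^ (d / 2 + 1 : ℝ) := by
  have hd0 : (0 : ℝ) < d := by exact_mod_cast hd
  set a : ℝ := 1 - 2 / (d : ℝ) * ((d / 2 : ℕ) : ℝ) with ha
  have ha0 : 0 ≤ a := gaussianExponent_nonneg d
  have e : ∀ᵐ p ∂radialNoise d, radial d p.1 p.2 ^ k =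
      (∏ i, p.1 i ^ (2 * k / d : ℝ)) * Real.exp (-(k * a) * p.2 ^ 2) := by
    have h : ∀ᵐ U ∂(volume.restrict (Icc 0 1) : Measure (Fin (d / 2 + 1) → ℝ)), U ∈ Icc 0 1 :=
      ae_restrict_mem measurableSet_Icc
    have := (Measure.quasiMeasurePreserving_fst (μ := volume.restrict (Icc 0 1))
      (ν := gaussianReal 0 1)).ae h
    filter_upwards [this] with p hp
    have h0 : 0 ≤ ∏ i, p.1 i := Finset.prod_nonneg fun i _ => hp.1 i
    rw [Real.finsetProd_rpow _ _ fun i _ => hp.1 i, radial, mul_pow, ← Real.exp_nat_mul,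
      ← Real.rpow_natCast (_ ^ _) k, ← Real.rpow_mul h0]
    congr 2
    · ring
    · ring
  rw [integral_congr_ae e, radialNoise,
    integral_prod_mul (fun U : Fin (d / 2 + 1) → ℝ => ∏ i, U i ^ (2 * k / d : ℝ))
      (fun x : ℝ => Real.exp (-(k * a) * x ^ 2)),
    integral_exp_neg_mul_sq_gaussianReal (by positivity), restrict_Icc_eq_pi,
    integral_fintype_prod_eq_pow (fun x : ℝ => x ^ (2 * k / d : ℝ)),
    integral_Icc_rpow (by positivity), Fintype.card_fin]
  set b : ℝ := 1 / (1 + 2 * k / d : ℝ) with hb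
  have hb0 : 0 < b := by positivity
  rcases Nat.even_or_odd' d with ⟨m, hm | hm⟩
  · have h2 : d / 2 = m := by omega
    have ha' : a = 0 := by
      rw [ha, h2, hm]; push_cast
      have : (m : ℝ) ≠ 0 := by rintro h; simp [hm, h] at hd0
      field_simp; ring
    rw [ha', h2, ← Real.rpow_natCast b, hm]
    simp
  · have h2 : d / 2 = m := by omega
    have ha' : a = 1 / d := by
      rw [ha, h2]
      have : (d : ℝ) = 2 * m + 1 := by rw [hm]; push_cast; ring
      rw [this]
      have : (2 * m + 1 : ℝ) ≠ 0 := by positivity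
      field_simp; ring
    have : (1 / (1 + 2 * (k * a)) : ℝ) = b := by rw [ha', hb]; congr 1; ring
    rw [this, Real.sqrt_eq_rpow, h2, ← Real.rpow_natCast b, ← Real.rpow_add hb0]
    congr 1
    rw [hm]; push_cast; ring

/-- The law of the radial variable has density proportional to `heatWeight`. Up to scaling,
`-log R` is a sum of `⌊d/2⌋ + 1` exponential variables and, for odd `d`, half a squared Gaussian, so
it has a Gamma law; the moments of `R` give this without convolutions. -/
theorem integral_radial_mul_integral_heatWeight {d : ℕ} (hd : 1 ≤ d) {g : ℝ → ℝ}
    (hg : ContinuousOn g (Icc 0 1)) :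
    (∫ p, g (radial d p.1 p.2) ∂radialNoise d) * ∫ s in Ioo (0 : ℝ) 1, heatWeight d s =
      ∫ s in Ioo (0 : ℝ) 1, heatWeight d s * g s := by
  have hd0 : (0 : ℝ) < d := by exact_mod_cast hd
  set W := ∫ s in Ioo (0 : ℝ) 1, heatWeight d s with hW
  have hWpos : 0 < W := integral_heatWeight_pos hd
  have hm := measurable_heatWeight d
  set μ := (radialNoise d).map fun p => radial d p.1 p.2 with hμ
  set ν := (volume.restrict (Ioo (0 : ℝ) 1)).withDensity
    fun s => ENNReal.ofReal (heatWeight d s / W) with hν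
  have hνint : ∀ g : ℝ → ℝ, ∫ s, g s ∂ν = (∫ s in Ioo (0 : ℝ) 1, heatWeight d s * g s) / W := by
    intro g
    rw [hν, integral_withDensity_eq_integral_toReal_smul (by fun_prop) (by simp),
      ← integral_div]
    refine setIntegral_congr_fun measurableSet_Ioo fun s hs => ?_
    have := heatWeight_nonneg d hs.1
    simp only [smul_eq_mul]
    rw [ENNReal.toReal_ofReal (by positivity)]
    ring
  have : IsFiniteMeasure ν := by
    refine isFiniteMeasure_withDensity_ofReal ?_
    exact ((integrableOn_heatWeight hd).div_const W).2
  have : IsFiniteMeasure μ := by rw [hμ]; infer_instance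
  have hμae : ∀ᵐ x ∂μ, x ∈ Icc (0 : ℝ) 1 := by
    exact (ae_map_iff (measurable_radial d).aemeasurable
      (measurableSet_Icc : MeasurableSet (Icc (0 : ℝ) 1))).2 (ae_radial_mem_Icc d)
  have hνae : ∀ᵐ x ∂ν, x ∈ Icc (0 : ℝ) 1 := by
    refine (withDensity_absolutelyContinuous _ _).ae_le ?_
    filter_upwards [ae_restrict_mem measurableSet_Ioo] with x hx using Ioo_subset_Icc_self hx
  have hint : ∀ g : ℝ → ℝ, ContinuousOn g (Icc 0 1) →
      ∫ x, g x ∂μ = ∫ p, g (radial d p.1 p.2) ∂radialNoise d := by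
    intro g hg
    refine integral_map (measurable_radial d).aemeasurable ?_
    have := hg.aestronglyMeasurable_of_isCompact (μ := μ) isCompact_Icc measurableSet_Icc
    rwa [Measure.restrict_eq_self_of_ae_mem hμae] at this
  have hmom : ∀ k : ℕ, ∫ x, x ^ k ∂μ = ∫ x, x ^ k ∂ν := by
    intro k
    have h0 := integral_heatWeight_mul_pow hd 0
    simp only [pow_zero, mul_one, ← hW] at h0
    rw [hint (fun x => x ^ k) (by fun_prop), integral_radial_pow hd, hνint,
      integral_heatWeight_mul_pow hd, h0]
    have := Real.Gamma_pos_of_pos (show (0 : ℝ) < d / 2 + 1 by positivity)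
    rw [mul_div_mul_left _ _ (by positivity), mul_div_mul_right _ _ this.ne',
      ← Real.div_rpow (by positivity) (by positivity)]
    congr 1
    push_cast
    field_simp
    ring
  have := integral_eq_of_moments_eq hμae hνae hmom hg
  rw [hint g hg, hνint] at this
  rw [this, div_mul_cancel₀ _ hWpos.ne']

/-! ### The heat kernel and the unit heat ball -/

/-- The backward heat kernel `s^(-d/2) exp(-q²/(4s))` as a function of the distance `q`, normalised
so that the unit heat ball is the set where it exceeds `1`. -/
def kernel (d : ℕ) (s q : ℝ) : ℝ := s ^ (-(d / 2 : ℝ)) * Real.exp (-q ^ 2 / (4 * s))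

theorem kernel_eq_exp {d : ℕ} {s : ℝ} (hs : 0 < s) (q : ℝ) :
    kernel d s q = Real.exp (((d / 2 : ℝ) * (s * -Real.log s) * 4 - q ^ 2) / (4 * s)) := by
  rw [kernel, Real.rpow_def_of_pos hs, ← Real.exp_add]
  congr 1
  field_simp
  ring

theorem kernel_pos {d : ℕ} {s : ℝ} (hs : 0 < s) (q : ℝ) : 0 < kernel d s q := by
  rw [kernel_eq_exp hs]; exact Real.exp_pos _

theorem kernel_eq_exp_psi {d : ℕ} {s : ℝ} (hs : 0 < s) (hs1 : s ≤ 1) (q : ℝ) :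
    kernel d s q = Real.exp (((2 * psi d s) ^ 2 - q ^ 2) / (4 * s)) := by
  rw [kernel_eq_exp hs, mul_pow, psi_sq hs hs1]
  congr 2
  ring

theorem kernel_two_mul_psi {d : ℕ} {s : ℝ} (hs : 0 < s) (hs1 : s ≤ 1) :
    kernel d s (2 * psi d s) = 1 := by
  rw [kernel_eq_exp_psi hs hs1]; simp

theorem one_lt_kernel {d : ℕ} {s : ℝ} (hs : 0 < s) (hs1 : s ≤ 1) {q : ℝ} (hq : 0 ≤ q)
    (h : q < 2 * psi d s) : 1 < kernel d s q := by
  rw [kernel_eq_exp_psi hs hs1, Real.one_lt_exp_iff]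
  have : q ^ 2 < (2 * psi d s) ^ 2 := by gcongr
  have : 0 < (2 * psi d s) ^ 2 - q ^ 2 := by linarith
  positivity

theorem kernel_le_one {d : ℕ} {s : ℝ} (hs : 0 < s) (hs1 : s ≤ 1) {q : ℝ}
    (h : 2 * psi d s ≤ q) : kernel d s q ≤ 1 := by
  rw [kernel_eq_exp_psi hs hs1, Real.exp_le_one_iff]
  have h0 := psi_nonneg d s
  have : (2 * psi d s) ^ 2 ≤ q ^ 2 := by gcongr
  exact div_nonpos_of_nonpos_of_nonneg (by linarith) (by positivity)

theorem two_mul_psi_pos {d : ℕ} (hd : 1 ≤ d) {s : ℝ} (hs : 0 < s) (hs1 : s < 1) :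
    0 < 2 * psi d s := by
  have hd0 : (0 : ℝ) < d := by exact_mod_cast hd
  have hl := Real.log_neg hs hs1
  have : 0 < psi d s ^ 2 := by
    rw [psi_sq hs hs1.le]
    have : 0 < -Real.log s := by linarith
    positivity
  have := lt_of_le_of_ne (psi_nonneg d s) fun h => by rw [← h] at this; simp at this
  linarith

/-- The largest radius of a time slice of the unit heat ball, attained at `s = 1/e`. -/
theorem two_mul_psi_le {d : ℕ} {s : ℝ} (hs : 0 ≤ s) (hs1 : s ≤ 1) :
    2 * psi d s ≤ √(2 * d / Real.exp 1) := by
  refine Real.le_sqrt_of_sq_le ?_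
  rcases hs.eq_or_lt with rfl | hs
  · simp only [psi, zero_mul, Real.sqrt_zero, mul_zero, ne_eq, OfNat.ofNat_ne_zero,
      not_false_eq_true, zero_pow]
    positivity
  have h := Real.log_le_sub_one_of_pos (show 0 < (Real.exp 1 * s)⁻¹ by positivity)
  rw [Real.log_inv, Real.log_mul (Real.exp_pos 1).ne' hs.ne', Real.log_exp] at h
  have h2 : s * -Real.log s ≤ (Real.exp 1)⁻¹ := by
    have : s * -Real.log s ≤ s * (Real.exp 1 * s)⁻¹ := by
      gcongr; linarith
    refine this.trans_eq ?_
    field_simp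
  rw [mul_pow, psi_sq hs hs1]
  calc (2 : ℝ) ^ 2 * (d / 2 * (s * -Real.log s)) = 2 * d * (s * -Real.log s) := by ring
    _ ≤ 2 * d * (Real.exp 1)⁻¹ := by gcongr
    _ = _ := by ring

theorem continuousOn_kernel (d : ℕ) :
    ContinuousOn (fun p : ℝ × ℝ => kernel d p.1 p.2) (Ioi 0 ×ˢ univ) := by
  unfold kernel
  refine ContinuousOn.mul ?_ ?_
  · exact ContinuousOn.rpow_const (by fun_prop) fun p hp => Or.inl (ne_of_gt hp.1)
  · refine Real.continuous_exp.comp_continuousOn (ContinuousOn.div (by fun_prop) (by fun_prop) ?_)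
    intro p hp
    have : (0:ℝ) < p.1 := hp.1
    positivity

theorem hasDerivAt_kernel_time {d : ℕ} {s : ℝ} (hs : 0 < s) (q : ℝ) :
    HasDerivAt (fun s => kernel d s q)
      ((-(d / (2 * s) : ℝ) + q ^ 2 / (4 * s ^ 2)) * kernel d s q) s := by
  have h1 := Real.hasDerivAt_rpow_const (p := (-(d / 2 : ℝ))) (Or.inl hs.ne')
  have h2 : HasDerivAt (fun s : ℝ => -q ^ 2 / (4 * s)) (q ^ 2 / (4 * s ^ 2)) s := by
    have := ((hasDerivAt_id s).const_mul 4).fun_inv (by simp [hs.ne']) |>.const_mul (-q ^ 2)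
    simp only [id] at this
    convert! this using 1
    field_simp
  convert! h1.mul h2.exp using 1
  rw [kernel, Real.rpow_sub_one hs.ne']
  field_simp

theorem hasDerivAt_kernel_space {d : ℕ} {s : ℝ} (hs : 0 < s) (q : ℝ) :
    HasDerivAt (kernel d s) (-(q / (2 * s)) * kernel d s q) q := by
  have h2 : HasDerivAt (fun q : ℝ => -q ^ 2 / (4 * s)) (-(q / (2 * s))) q := by
    have := ((hasDerivAt_id q).pow 2).neg.div_const (4 * s)
    convert! this using 1
    simp; field_simp; ring
  convert! h2.exp.const_mul (s ^ (-(d / 2 : ℝ))) using 1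
  rw [kernel]; ring

theorem contDiff_kernel_norm {d : ℕ} (s : ℝ) {n : WithTop ℕ∞} :
    ContDiff ℝ n fun y : Space d => kernel d s ‖y‖ := by
  unfold kernel
  have := contDiff_norm_sq ℝ (E := Space d) (n := n)
  fun_prop

theorem fderiv_kernel_norm {d : ℕ} {s : ℝ} (hs : 0 < s) (y e : Space d) :
    fderiv ℝ (fun y : Space d => kernel d s ‖y‖) y e =
      -(kernel d s ‖y‖ / (2 * s)) * inner ℝ y e := by
  have h1 : HasFDerivAt (fun y : Space d => ‖y‖ ^ 2) (2 • innerSL ℝ y) y :=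
    (hasStrictFDerivAt_norm_sq y).hasFDerivAt
  have h2 := (((h1.fun_neg.mul_const (4 * s)⁻¹)).exp).const_mul (s ^ (-(d / 2 : ℝ)))
  have h3 : (fun y : Space d => kernel d s ‖y‖) =
      fun y => s ^ (-(d / 2 : ℝ)) * Real.exp (-‖y‖ ^ 2 * (4 * s)⁻¹) := by
    ext y; simp only [kernel, div_eq_mul_inv]
  rw [h3, h2.fderiv, kernel]
  simp
  field_simp
  ring

/-! ### Polar coordinates and Green's identity -/

/-- Integration in polar coordinates for a function that need not be radial. -/
theorem integral_eq_integral_sphere {d : ℕ} (hd : 1 ≤ d) {f : Space d → ℝ} (hf : Integrable f) :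
    ∫ y, f y = ∫ θ : Metric.sphere (0 : Space d) 1,
      (∫ q in Ioi (0 : ℝ), q ^ (d - 1) * f (q • (θ : Space d)))
        ∂(volume : Measure (Space d)).toSphere := by
  have : Nonempty (Fin d) := ⟨⟨0, hd⟩⟩
  have : Nontrivial (Space d) := by
    refine ⟨⟨0, EuclideanSpace.single ⟨0, hd⟩ 1, fun h => ?_⟩⟩
    have := congrArg (fun x : Space d => x ⟨0, hd⟩) h
    simp at this
  have hmp := (volume : Measure (Space d)).measurePreserving_homeomorphUnitSphereProd
  have hemb := (homeomorphUnitSphereProd (Space d)).measurableEmbedding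
  set F : Metric.sphere (0 : Space d) 1 × Ioi (0 : ℝ) → ℝ := fun p => f (p.2.1 • p.1.1) with hF
  have hFcomp : ∀ x : ({0}ᶜ : Set (Space d)), F (homeomorphUnitSphereProd _ x) = f x := by
    intro x
    have hx : ‖x.1‖ ≠ 0 := norm_ne_zero_iff.2 x.2
    simp [hF, smul_smul, hx]
  have hFint : Integrable F ((volume : Measure (Space d)).toSphere.prod
      (Measure.volumeIoiPow (Module.finrank ℝ (Space d) - 1))) := by
    rw [← hmp.integrable_comp_emb hemb]
    have h2 : F ∘ homeomorphUnitSphereProd (Space d) = fun x => f x.1 := funext hFcomp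
    rw [h2]
    have := (hf.integrableOn (s := ({0}ᶜ : Set (Space d))))
    rwa [integrableOn_iff_comap_subtypeVal (measurableSet_singleton _).compl] at this
  calc ∫ y, f y = ∫ x : ({0}ᶜ : Set (Space d)), f x ∂(volume.comap Subtype.val) := by
        rw [integral_subtype_comap (measurableSet_singleton _).compl fun x ↦ f x,
          restrict_compl_singleton]
    _ = ∫ p, F p ∂((volume : Measure (Space d)).toSphere.prod
      (Measure.volumeIoiPow (Module.finrank ℝ (Space d) - 1))) := by
        rw [← hmp.integral_comp hemb]
        simp_rw [hFcomp]
    _ = _ := by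
        rw [integral_prod _ hFint]
        refine integral_congr_ae (ae_of_all _ fun θ => ?_)
        simp only [hF]
        rw [Measure.volumeIoiPow, integral_withDensity_eq_integral_toReal_smul (by fun_prop)
          (ae_of_all _ fun _ => ENNReal.ofReal_lt_top)]
        rw [integral_subtype_comap measurableSet_Ioi
          (fun q : ℝ =>
            (ENNReal.ofReal (q ^ (Module.finrank ℝ (Space d) - 1))).toReal • f (q • θ.1))]
        refine setIntegral_congr_fun measurableSet_Ioi fun q hq => ?_
        have : (0:ℝ) < q := hq
        simp only [smul_eq_mul, finrank_euclideanSpace_fin]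
        rw [ENNReal.toReal_ofReal (by positivity)]

theorem laplacian_eq_sum {d : ℕ} (w : Space d → ℝ) (y : Space d) :
    Laplacian.laplacian w y = ∑ i, fderiv ℝ (fderiv ℝ w) y (EuclideanSpace.basisFun (Fin d) ℝ i)
      (EuclideanSpace.basisFun (Fin d) ℝ i) := by
  rw [InnerProductSpace.laplacian_eq_iteratedFDeriv_orthonormalBasis w
    (EuclideanSpace.basisFun (Fin d) ℝ)]
  simp [iteratedFDeriv_two_apply]

/-- Green's identity in one direction, on a ball that is a superlevel set `{p > 1}`: integration by
parts against the Lipschitz function `max (p - 1) 0`, which produces no boundary term. -/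
theorem integral_fderiv_fderiv_mul {d : ℕ} {w p : Space d → ℝ} {r r₁ : ℝ} (hr : 0 < r)
    (hr₁ : r < r₁) (hw : ContDiffOn ℝ 2 w (Metric.ball 0 r₁)) (hp : ContDiff ℝ 1 p)
    (hp0 : ∀ y, 0 ≤ p y) (hpin : ∀ y, ‖y‖ < r → 1 < p y) (hpout : ∀ y, r ≤ ‖y‖ → p y ≤ 1)
    (e : Space d) :
    ∫ y in Metric.ball 0 r, fderiv ℝ (fderiv ℝ w) y e e * (p y - 1) =
      -∫ y in Metric.ball 0 r, fderiv ℝ w y e * fderiv ℝ p y e := by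
  -- `w` is smooth only on the ball of radius `r₁` and `p` need not have compact support; a cutoff
  -- equal to `1` on the ball of radius `r` mends both
  set χ : ContDiffBump (0 : Space d) :=
    ⟨(2 * r + r₁) / 3, (r + 2 * r₁) / 3, by linarith, by linarith⟩ with hχ
  have hχin : ∀ y : Space d, ‖y‖ ≤ r → χ y = 1 := fun y hy =>
    χ.one_of_mem_closedBall (by
      rw [mem_closedBall_zero_iff]; refine hy.trans ?_; simp only [hχ]; linarith)
  have hχev : ∀ y : Space d, ‖y‖ < r → χ =ᶠ[𝓝 y] fun _ => (1 : ℝ) := by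
    intro y hy
    filter_upwards [Metric.isOpen_ball.mem_nhds (mem_ball_zero_iff.2 hy)] with z hz
    exact hχin z (mem_ball_zero_iff.1 hz).le
  have hdw : ContDiffOn ℝ 1 (fun y => fderiv ℝ w y e) (Metric.ball 0 r₁) :=
    (hw.fderiv_of_isOpen Metric.isOpen_ball (by norm_num)).clm_apply contDiffOn_const
  set F : Space d → ℝ := fun y => χ y * fderiv ℝ w y e with hF
  have hFc : HasCompactSupport F := χ.hasCompactSupport.mul_right
  have hFd : ContDiff ℝ 1 F := by
    rw [contDiff_iff_contDiffAt]
    intro y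
    by_cases hy : y ∈ Metric.ball (0 : Space d) r₁
    · exact χ.contDiff.contDiffAt.mul (hdw.contDiffAt (Metric.isOpen_ball.mem_nhds hy))
    · have : F =ᶠ[𝓝 y] fun _ => 0 := by
        have hy' : y ∈ (tsupport χ)ᶜ := by
          rw [χ.tsupport_eq]
          simp only [mem_ball_zero_iff, not_lt] at hy
          simp only [mem_compl_iff, mem_closedBall_zero_iff, not_le, hχ]
          linarith
        filter_upwards [(isClosed_tsupport _).isOpen_compl.mem_nhds hy'] with z hz
        simp [hF, image_eq_zero_of_notMem_tsupport hz]
      exact contDiffAt_const.congr_of_eventuallyEq this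
  set q : Space d → ℝ := fun y => χ y * p y with hq
  have hqc : HasCompactSupport q := χ.hasCompactSupport.mul_right
  have hqd : ContDiff ℝ 1 q := χ.contDiff.mul hp
  set h : Space d → ℝ := fun y => max (q y - 1) 0 with hh
  obtain ⟨C, hC⟩ := hFd.lipschitzWith_of_hasCompactSupport hFc one_ne_zero
  obtain ⟨C', hC'⟩ := hqd.lipschitzWith_of_hasCompactSupport hqc one_ne_zero
  have hhL : LipschitzWith (C' + 0) h := (hC'.sub (LipschitzWith.const 1)).max_const 0
  have hhout : ∀ y, r ≤ ‖y‖ → h y = 0 := by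
    intro y hy
    refine max_eq_right (sub_nonpos.2 ?_)
    exact mul_le_one₀ χ.le_one (hp0 y) (hpout y hy)
  have hhin : ∀ y, ‖y‖ < r → h y = p y - 1 := by
    intro y hy
    rw [hh]
    simp only [hq, hχin y hy.le, one_mul]
    exact max_eq_left (by linarith [hpin y hy])
  have hhc : HasCompactSupport h := by
    refine HasCompactSupport.intro (isCompact_closedBall (0 : Space d) r) fun y hy => hhout y ?_
    simp only [mem_closedBall_zero_iff, not_le] at hy
    exact hy.le
  have key := hC.integral_lineDeriv_mul_eq (μ := volume) hhL hhc e
  have hL : ∀ y, lineDeriv ℝ F y e * h y = (Metric.ball (0 : Space d) r).indicator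
      (fun y => fderiv ℝ (fderiv ℝ w) y e e * (p y - 1)) y := by
    intro y
    by_cases hy : y ∈ Metric.ball (0 : Space d) r
    · have hy' := mem_ball_zero_iff.1 hy
      rw [indicator_of_mem hy, hhin y hy',
        ((hFd.differentiable one_ne_zero) y).lineDeriv_eq_fderiv]
      congr 1
      have : F =ᶠ[𝓝 y] fun y => fderiv ℝ w y e := by
        filter_upwards [hχev y hy'] with z hz
        simp [hF, hz]
      rw [this.fderiv_eq]
      have hd2 : DifferentiableAt ℝ (fderiv ℝ w) y :=
        ((hw.fderiv_of_isOpen Metric.isOpen_ball (m := 1) (by norm_num)).contDiffAt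
          (Metric.isOpen_ball.mem_nhds (Metric.ball_subset_ball hr₁.le hy))).differentiableAt
            one_ne_zero
      rw [fderiv_clm_apply hd2 (differentiableAt_const e)]
      simp
    · rw [indicator_of_notMem hy, hhout y (by simpa using hy), mul_zero]
  -- `h` need not be differentiable on the sphere of radius `r`, which is a null set
  have hR : ∀ᵐ y ∂(volume : Measure (Space d)), lineDeriv ℝ h y (-e) * F y =
      (Metric.ball (0 : Space d) r).indicator
        (fun y => -(fderiv ℝ w y e * fderiv ℝ p y e)) y := by
    have hnull : ∀ᵐ y ∂(volume : Measure (Space d)), y ∉ Metric.sphere (0 : Space d) r :=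
      measure_eq_zero_iff_ae_notMem.1 (Measure.addHaar_sphere_of_ne_zero _ _ hr.ne')
    filter_upwards [hnull] with y hy
    by_cases hyr : y ∈ Metric.ball (0 : Space d) r
    · have hy' := mem_ball_zero_iff.1 hyr
      rw [indicator_of_mem hyr]
      have : h =ᶠ[𝓝 y] fun y => p y - 1 := by
        filter_upwards [Metric.isOpen_ball.mem_nhds hyr] with z hz
        exact hhin z (mem_ball_zero_iff.1 hz)
      rw [this.lineDeriv_eq, DifferentiableAt.lineDeriv_eq_fderiv
        (((hp.differentiable one_ne_zero) y).sub_const 1), fderiv_sub_const, map_neg]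
      simp only [hF, hχin y hy'.le]
      ring
    · rw [indicator_of_notMem hyr]
      have hy' : r < ‖y‖ := by
        simp only [mem_ball_zero_iff, not_lt, mem_sphere_zero_iff_norm] at hyr hy
        exact lt_of_le_of_ne hyr (Ne.symm hy)
      have : h =ᶠ[𝓝 y] fun _ => 0 := by
        filter_upwards [(isOpen_lt continuous_const continuous_norm).mem_nhds hy'] with z hz
        exact hhout z (le_of_lt hz)
      rw [this.lineDeriv_eq]
      simp [lineDeriv]
  simp_rw [hL] at key
  rw [integral_congr_ae hR, integral_indicator measurableSet_ball,
    integral_indicator measurableSet_ball, integral_neg] at key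
  exact key

/-- Green's identity on the unit heat ball at a fixed time: the gradient of the heat kernel is
radial, so only the derivative of `w` in the radial direction appears. -/
theorem integral_laplacian_mul_kernel {d : ℕ} (hd : 1 ≤ d) {w : Space d → ℝ} {s r₁ : ℝ}
    (hs : 0 < s) (hs1 : s < 1) (hr₁ : 2 * psi d s < r₁)
    (hw : ContDiffOn ℝ 2 w (Metric.ball 0 r₁)) :
    ∫ y in Metric.ball 0 (2 * psi d s), Laplacian.laplacian w y * (kernel d s ‖y‖ - 1) =
      ∫ y in Metric.ball 0 (2 * psi d s), kernel d s ‖y‖ / (2 * s) * fderiv ℝ w y y := by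
  set r := 2 * psi d s with hr
  have hr0 : 0 < r := two_mul_psi_pos hd hs hs1
  set b := EuclideanSpace.basisFun (Fin d) ℝ with hb
  have hsub : Metric.closedBall (0 : Space d) r ⊆ Metric.ball 0 r₁ :=
    Metric.closedBall_subset_ball hr₁
  have hp : ContDiff ℝ 1 fun y : Space d => kernel d s ‖y‖ := contDiff_kernel_norm s
  have h1 : ContinuousOn (fderiv ℝ w) (Metric.ball 0 r₁) :=
    (hw.fderiv_of_isOpen Metric.isOpen_ball (m := 1) (by norm_num)).continuousOn
  have h2 : ContinuousOn (fderiv ℝ (fderiv ℝ w)) (Metric.ball 0 r₁) :=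
    ((hw.fderiv_of_isOpen Metric.isOpen_ball (m := 1) (by norm_num)).fderiv_of_isOpen
      Metric.isOpen_ball (m := 0) (by norm_num)).continuousOn
  have hint : ∀ f : Space d → ℝ, ContinuousOn f (Metric.ball 0 r₁) →
      IntegrableOn f (Metric.ball 0 r) := fun f hf =>
    ((hf.mono hsub).integrableOn_compact (isCompact_closedBall _ _)).mono_set
      Metric.ball_subset_closedBall
  have key : ∀ i, ∫ y in Metric.ball 0 r, fderiv ℝ (fderiv ℝ w) y (b i) (b i) *
      (kernel d s ‖y‖ - 1) = -∫ y in Metric.ball 0 r, fderiv ℝ w y (b i) *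
        fderiv ℝ (fun y : Space d => kernel d s ‖y‖) y (b i) :=
    fun i => integral_fderiv_fderiv_mul hr0 hr₁ hw hp (fun y => (kernel_pos hs _).le)
    (fun y hy => one_lt_kernel hs hs1.le (norm_nonneg y) hy)
    (fun y hy => kernel_le_one hs hs1.le hy) (b i)
  simp_rw [laplacian_eq_sum, ← hb, Finset.sum_mul]
  rw [integral_finsetSum _ fun i _ => hint _ ?_]
  · simp_rw [key, ← integral_neg]
    rw [← integral_finsetSum _ fun i _ => hint _ ?_]
    · refine setIntegral_congr_fun measurableSet_ball fun y _ => ?_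
      -- `fderiv ℝ w y y` is the sum of the partial derivatives weighted by the coordinates of `y`
      conv_rhs => rw [show fderiv ℝ w y y = fderiv ℝ w y (∑ i, inner ℝ (b i) y • b i) by
        rw [b.sum_repr' y]]
      rw [map_sum, Finset.mul_sum]
      refine Finset.sum_congr rfl fun i _ => ?_
      rw [fderiv_kernel_norm hs, map_smul, smul_eq_mul, real_inner_comm]
      ring
    · exact ((h1.clm_apply continuousOn_const).mul
        ((hp.continuous_fderiv one_ne_zero).clm_apply continuous_const).continuousOn).neg
  · exact ((h2.clm_apply continuousOn_const).clm_apply continuousOn_const).mul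
      (hp.continuous.continuousOn.sub continuousOn_const)

/-! ### The mean value formula on the unit heat ball -/

/-- `v` solves the backward heat equation `∂_s v = -Δ v` on `(0,1) × B(0,r₁)` and is continuous up
to the boundary of this cylinder. A solution of the heat equation seen from a point `(t,x)`, that is
`v s y = u (t - a s) (x + √a y)`, has this property. -/
structure IsBackwardCaloric {d : ℕ} (r₁ : ℝ) (v : ℝ → Space d → ℝ) : Prop where
  continuousOn : ContinuousOn (fun p : ℝ × Space d => v p.1 p.2)
    (Icc 0 1 ×ˢ Metric.closedBall 0 r₁)
  hasDerivAt : ∀ s ∈ Ioo (0 : ℝ) 1, ∀ y ∈ Metric.ball (0 : Space d) r₁,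
    HasDerivAt (fun s => v s y) (-Laplacian.laplacian (v s) y) s
  contDiffOn : ∀ s ∈ Ioo (0 : ℝ) 1, ContDiffOn ℝ 2 (v s) (Metric.ball 0 r₁)
  continuousOn_laplacian : ContinuousOn (fun p : ℝ × Space d => Laplacian.laplacian (v p.1) p.2)
    (Ioo 0 1 ×ˢ Metric.ball 0 r₁)

/-- The integral of `v` at time `s` against the truncated heat kernel `max (kernel - 1) 0`, which
vanishes outside of the heat ball. It interpolates between a multiple of `v 0 0` at `s = 0` and `0`
at `s = 1`. -/
def heatIntegral {d : ℕ} (r₁ : ℝ) (v : ℝ → Space d → ℝ) (s : ℝ) : ℝ :=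
  ∫ y in Metric.ball 0 r₁, v s y * max (kernel d s ‖y‖ - 1) 0

theorem lipschitzOnWith_mul_of_bounds {f g : ℝ → ℝ} {S : Set ℝ} {A A' B B' : ℝ}
    (hf : ∀ s ∈ S, ∀ t ∈ S, |f s - f t| ≤ A * |s - t|) (hf' : ∀ s ∈ S, |f s| ≤ A')
    (hg : ∀ s ∈ S, ∀ t ∈ S, |g s - g t| ≤ B * |s - t|) (hg' : ∀ s ∈ S, |g s| ≤ B') :
    LipschitzOnWith (Real.nnabs (A * B' + A' * B)) (fun s => f s * g s) S := by
  refine LipschitzOnWith.of_dist_le_mul fun s hs t ht => ?_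
  rw [Real.dist_eq, Real.dist_eq, Real.coe_nnabs]
  have h1 : |f s * g s - f t * g t| ≤ |f s - f t| * |g s| + |f t| * |g s - g t| := by
    rw [← abs_mul, ← abs_mul]
    refine le_trans (le_of_eq ?_) (abs_add_le _ _)
    congr 1; ring
  have h2 : |f s - f t| * |g s| ≤ A * |s - t| * B' :=
    mul_le_mul (hf s hs t ht) (hg' s hs) (abs_nonneg _) ((abs_nonneg _).trans (hf s hs t ht))
  have h3 : |f t| * |g s - g t| ≤ A' * (B * |s - t|) :=
    mul_le_mul (hf' t ht) (hg s hs t ht) (abs_nonneg _) ((abs_nonneg _).trans (hf' t ht))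
  calc |f s * g s - f t * g t| ≤ (A * B' + A' * B) * |s - t| := by linarith
    _ ≤ _ := by gcongr; exact le_abs_self _

theorem abs_sub_le_of_hasDerivAt {f f' : ℝ → ℝ} {a b M : ℝ}
    (h : ∀ s ∈ Ioo a b, HasDerivAt f (f' s) s) (hM : ∀ s ∈ Ioo a b, |f' s| ≤ M) :
    ∀ s ∈ Ioo a b, ∀ t ∈ Ioo a b, |f s - f t| ≤ M * |s - t| := fun _ hs _ ht =>
  (convex_Ioo a b).norm_image_sub_le_of_norm_hasDerivWithin_le
    (fun x hx => (h x hx).hasDerivWithinAt) hM ht hs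

theorem continuous_kernel_norm {d : ℕ} (s : ℝ) : Continuous fun y : Space d => kernel d s ‖y‖ :=
  (contDiff_kernel_norm (n := 0) s).continuous

theorem IsBackwardCaloric.continuousOn_slice {d : ℕ} {r₁ : ℝ} {v : ℝ → Space d → ℝ}
    (hv : IsBackwardCaloric r₁ v) {s : ℝ} (hs : s ∈ Icc (0 : ℝ) 1) :
    ContinuousOn (v s) (Metric.closedBall 0 r₁) :=
  hv.continuousOn.comp (f := fun y => (s, y)) (by fun_prop) fun _ hy => ⟨hs, hy⟩

/-- Differentiation under the integral sign. The truncated kernel is Lipschitz in time and vanishes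
on the boundary of the heat ball, so the motion of that boundary does not contribute. -/
theorem hasDerivAt_heatIntegral {d : ℕ} {r₁ : ℝ} {v : ℝ → Space d → ℝ} (hd : 1 ≤ d)
    (hr₁ : √(2 * d / Real.exp 1) < r₁) (hv : IsBackwardCaloric r₁ v) {s : ℝ}
    (hs : s ∈ Ioo (0 : ℝ) 1) :
    HasDerivAt (heatIntegral r₁ v)
      (∫ y in Metric.ball 0 (2 * psi d s), (-Laplacian.laplacian (v s) y * (kernel d s ‖y‖ - 1) +
        v s y * ((-(d / (2 * s) : ℝ) + ‖y‖ ^ 2 / (4 * s ^ 2)) * kernel d s ‖y‖))) s := by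
  set R := √(2 * d / Real.exp 1) with hR
  set r := 2 * psi d s with hr
  have hr0 : 0 < r := two_mul_psi_pos hd hs.1 hs.2
  have hrR : r ≤ R := two_mul_psi_le hs.1.le hs.2.le
  set r₂ := (R + r₁) / 2 with hr₂
  have h2 : R < r₂ := by rw [hr₂]; linarith
  have h21 : r₂ < r₁ := by rw [hr₂]; linarith
  set a := s / 2 with ha
  set b := (s + 1) / 2 with hb
  have hab : Icc a b ⊆ Ioo 0 1 := fun x hx => ⟨by have := hs.1; linarith [hx.1],
    by have := hs.2; linarith [hx.2]⟩
  have hsab : s ∈ Ioo a b := ⟨by have := hs.1; linarith, by have := hs.2; linarith⟩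
  have hsub2 : Metric.closedBall (0 : Space d) r₂ ⊆ Metric.ball 0 r₁ :=
    Metric.closedBall_subset_ball h21
  have hcpt : IsCompact (Icc a b ×ˢ Metric.closedBall (0 : Space d) r₂) :=
    isCompact_Icc.prod (isCompact_closedBall _ _)
  have hcpt' : IsCompact (Icc a b ×ˢ Icc (0 : ℝ) r₂) := isCompact_Icc.prod isCompact_Icc
  -- bounds for `v`, the kernel, and their time derivatives on the support near time `s`
  obtain ⟨A, hA⟩ := hcpt.exists_bound_of_continuousOn
    (hv.continuousOn_laplacian.mono (prod_mono hab hsub2))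
  obtain ⟨A', hA'⟩ := hcpt.exists_bound_of_continuousOn
    (hv.continuousOn.mono (prod_mono (hab.trans Ioo_subset_Icc_self)
      (hsub2.trans Metric.ball_subset_closedBall)))
  have hkc : ContinuousOn (fun p : ℝ × ℝ => kernel d p.1 p.2) (Icc a b ×ˢ Icc (0 : ℝ) r₂) :=
    (continuousOn_kernel d).mono fun p hp => ⟨(hab hp.1).1, mem_univ _⟩
  obtain ⟨B', hB'⟩ := hcpt'.exists_bound_of_continuousOn hkc
  have hkc' : ContinuousOn (fun p : ℝ × ℝ => (-(d / (2 * p.1) : ℝ) + p.2 ^ 2 / (4 * p.1 ^ 2)) *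
      kernel d p.1 p.2) (Icc a b ×ˢ Icc (0 : ℝ) r₂) := by
    refine ContinuousOn.mul (ContinuousOn.add (ContinuousOn.neg ?_) ?_) hkc
    · exact ContinuousOn.div (by fun_prop) (by fun_prop) fun p hp =>
        (mul_pos two_pos (hab hp.1).1).ne'
    · exact ContinuousOn.div (by fun_prop) (by fun_prop) fun p hp =>
        (mul_pos four_pos (pow_pos (hab hp.1).1 2)).ne'
  obtain ⟨B, hB⟩ := hcpt'.exists_bound_of_continuousOn hkc'
  have hmeasF : ∀ σ ∈ Icc (0 : ℝ) 1,
      ContinuousOn (fun y => v σ y * max (kernel d σ ‖y‖ - 1) 0) (Metric.closedBall 0 r₁) :=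
    fun σ hσ => (hv.continuousOn_slice hσ).mul
      (((continuous_kernel_norm σ).sub continuous_const).max continuous_const).continuousOn
  have hout : ∀ σ ∈ Ioo (0 : ℝ) 1, ∀ q, 2 * psi d σ ≤ q → max (kernel d σ q - 1) 0 = 0 :=
    fun σ hσ q hq => max_eq_right (sub_nonpos.2 (kernel_le_one hσ.1 hσ.2.le hq))
  set F' : Space d → ℝ := fun y => -Laplacian.laplacian (v s) y * (kernel d s ‖y‖ - 1) +
        v s y * ((-(d / (2 * s) : ℝ) + ‖y‖ ^ 2 / (4 * s ^ 2)) * kernel d s ‖y‖) with hF'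
  have hkr : ∀ y : Space d, HasDerivAt (fun σ => kernel d σ ‖y‖)
      ((-(d / (2 * s) : ℝ) + ‖y‖ ^ 2 / (4 * s ^ 2)) * kernel d s ‖y‖) s :=
    fun y => hasDerivAt_kernel_time hs.1 _
  have hsubr : Metric.ball (0 : Space d) r ⊆ Metric.ball 0 r₁ :=
    Metric.ball_subset_ball (by linarith)
  have : IsFiniteMeasure (volume.restrict (Metric.ball (0 : Space d) r₁)) :=
    ⟨by simpa using measure_ball_lt_top⟩
  have key := (hasDerivAt_integral_of_dominated_loc_of_lip
    (μ := volume.restrict (Metric.ball (0 : Space d) r₁))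
    (F := fun σ y => v σ y * max (kernel d σ ‖y‖ - 1) 0)
    (F' := (Metric.ball (0 : Space d) r).indicator F') (x₀ := s) (s := Ioo a b)
    (bound := fun _ => A * (B' + 1) + A' * B) (Ioo_mem_nhds hsab.1 hsab.2)
    ?_ ?_ ?_ ?_ (integrable_const _) ?_).2
  · rw [integral_indicator measurableSet_ball, Measure.restrict_restrict measurableSet_ball,
      inter_eq_left.2 hsubr] at key
    exact key
  · filter_upwards [Ioo_mem_nhds hs.1 hs.2] with σ hσ
    exact ((hmeasF σ (Ioo_subset_Icc_self hσ)).mono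
      Metric.ball_subset_closedBall).aestronglyMeasurable measurableSet_ball
  · exact ((hmeasF s (Ioo_subset_Icc_self hs)).integrableOn_compact
      (isCompact_closedBall _ _)).mono_set Metric.ball_subset_closedBall
  · refine AEStronglyMeasurable.indicator ?_ measurableSet_ball
    refine ContinuousOn.aestronglyMeasurable ?_ measurableSet_ball
    have hl : ContinuousOn (fun y => Laplacian.laplacian (v s) y) (Metric.ball 0 r₁) :=
      hv.continuousOn_laplacian.comp (f := fun y => (s, y)) (by fun_prop) fun _ hy => ⟨hs, hy⟩
    have hk := continuous_kernel_norm (d := d) s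
    refine ContinuousOn.add (hl.neg.mul (hk.sub continuous_const).continuousOn) (ContinuousOn.mul
      ((hv.continuousOn_slice (Ioo_subset_Icc_self hs)).mono Metric.ball_subset_closedBall)
      (ContinuousOn.mul ?_ hk.continuousOn))
    fun_prop
  · filter_upwards [ae_restrict_mem measurableSet_ball] with y hy
    by_cases hy2 : y ∈ Metric.closedBall (0 : Space d) r₂
    · have hyn : ‖y‖ ∈ Icc 0 r₂ := ⟨norm_nonneg y, mem_closedBall_zero_iff.1 hy2⟩
      refine lipschitzOnWith_mul_of_bounds (abs_sub_le_of_hasDerivAt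
        (fun σ hσ => hv.hasDerivAt σ (hab (Ioo_subset_Icc_self hσ)) y hy) fun σ hσ => ?_)
        (fun σ hσ => hA' (σ, y) ⟨Ioo_subset_Icc_self hσ, hy2⟩) ?_ fun σ hσ => ?_
      · rw [abs_neg]; exact hA (σ, y) ⟨Ioo_subset_Icc_self hσ, hy2⟩
      · intro σ hσ τ hτ
        refine (abs_max_sub_max_le_abs _ _ _).trans ?_
        rw [sub_sub_sub_cancel_right]
        exact abs_sub_le_of_hasDerivAt (fun σ hσ => hasDerivAt_kernel_time
          (hab (Ioo_subset_Icc_self hσ)).1 _)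
          (fun σ hσ => hB (σ, ‖y‖) ⟨Ioo_subset_Icc_self hσ, hyn⟩) σ hσ τ hτ
      · have hk := hB' (σ, ‖y‖) ⟨Ioo_subset_Icc_self hσ, hyn⟩
        have hk0 := kernel_pos (d := d) (hab (Ioo_subset_Icc_self hσ)).1 ‖y‖
        rw [Real.norm_eq_abs, abs_of_pos hk0] at hk
        rw [abs_of_nonneg (le_max_right _ _)]
        exact max_le (by linarith) (by linarith)
    -- outside of the ball of radius `r₂` the truncated kernel vanishes at all times
    · refine LipschitzOnWith.of_dist_le_mul fun σ hσ τ hτ => ?_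
      have hyn : R ≤ ‖y‖ := by
        simp only [mem_closedBall_zero_iff, not_le] at hy2
        linarith
      have hz : ∀ σ ∈ Ioo a b, max (kernel d σ ‖y‖ - 1) 0 = 0 := fun σ hσ => by
        have h := hab (Ioo_subset_Icc_self hσ)
        exact hout σ h _ ((two_mul_psi_le h.1.le h.2.le).trans hyn)
      simp only [hz σ hσ, hz τ hτ, mul_zero, dist_self]
      positivity
  -- off the null sphere of radius `r` the sign of `kernel - 1` is locally constant in time
  · have hnull : ∀ᵐ y ∂(volume : Measure (Space d)), y ∉ Metric.sphere (0 : Space d) r :=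
      measure_eq_zero_iff_ae_notMem.1 (Measure.addHaar_sphere_of_ne_zero _ _ hr0.ne')
    filter_upwards [ae_restrict_mem measurableSet_ball, ae_restrict_of_ae hnull] with y hy hyr
    by_cases hyb : y ∈ Metric.ball (0 : Space d) r
    · rw [indicator_of_mem hyb]
      have h1 : 1 < kernel d s ‖y‖ :=
        one_lt_kernel hs.1 hs.2.le (norm_nonneg y) (mem_ball_zero_iff.1 hyb)
      have hev : (fun σ => v σ y * max (kernel d σ ‖y‖ - 1) 0) =ᶠ[𝓝 s]
          fun σ => v σ y * (kernel d σ ‖y‖ - 1) := by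
        filter_upwards [(hkr y).continuousAt.eventually (lt_mem_nhds h1)] with σ hσ
        rw [max_eq_left (sub_nonneg.2 (le_of_lt hσ))]
      exact ((hv.hasDerivAt s hs y hy).mul ((hkr y).sub_const 1)).congr_of_eventuallyEq hev
    · rw [indicator_of_notMem hyb]
      have h1 : kernel d s ‖y‖ < 1 := by
        simp only [mem_ball_zero_iff, not_lt, mem_sphere_zero_iff_norm] at hyb hyr
        rw [kernel_eq_exp_psi hs.1 hs.2.le, Real.exp_lt_one_iff]
        have : r < ‖y‖ := lt_of_le_of_ne hyb (Ne.symm hyr)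
        have : r ^ 2 < ‖y‖ ^ 2 := by gcongr
        exact div_neg_of_neg_of_pos (by linarith) (by linarith [hs.1])
      have hev : (fun σ => v σ y * max (kernel d σ ‖y‖ - 1) 0) =ᶠ[𝓝 s] fun _ => 0 := by
        filter_upwards [(hkr y).continuousAt.eventually (gt_mem_nhds h1)] with σ hσ
        rw [max_eq_right (sub_nonpos.2 (le_of_lt hσ)), mul_zero]
      exact (hasDerivAt_const s (0 : ℝ)).congr_of_eventuallyEq hev

theorem integral_ball_eq_integral_sphere {d : ℕ} (hd : 1 ≤ d) {f : Space d → ℝ} {r : ℝ}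
    (hr : 0 ≤ r) (hf : IntegrableOn f (Metric.ball 0 r)) :
    ∫ y in Metric.ball 0 r, f y = ∫ θ : Metric.sphere (0 : Space d) 1,
      (∫ q in (0 : ℝ)..r, q ^ (d - 1) * f (q • (θ : Space d)))
        ∂(volume : Measure (Space d)).toSphere := by
  rw [← integral_indicator measurableSet_ball,
    integral_eq_integral_sphere hd (hf.integrable_indicator measurableSet_ball)]
  refine integral_congr_ae (ae_of_all _ fun θ => ?_)
  simp only
  have hmem : ∀ q : ℝ, 0 < q → (q • (θ : Space d) ∈ Metric.ball (0 : Space d) r ↔ q ∈ Iio r) := by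
    intro q hq
    have : ‖(θ : Space d)‖ = 1 := mem_sphere_zero_iff_norm.1 θ.2
    simp [norm_smul, this, abs_of_pos hq]
  rw [intervalIntegral.integral_of_le hr, integral_Ioc_eq_integral_Ioo, ← Ioi_inter_Iio,
    ← setIntegral_indicator measurableSet_Iio]
  refine setIntegral_congr_fun measurableSet_Ioi fun q hq => ?_
  by_cases h : q ∈ Iio r
  · simp only [indicator_of_mem h, indicator_of_mem ((hmem q hq).2 h)]
  · simp only [indicator_of_notMem h, indicator_of_notMem (mt (hmem q hq).1 h), mul_zero]

/-- Along a ray the integrand of Green's identity is, in polar coordinates, the derivative of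
`-(1/2s) q^d kernel(s,q) w(qθ)`. -/
theorem integral_ray {d : ℕ} (hd : 1 ≤ d) {w : Space d → ℝ} {s r₁ : ℝ} (hs : 0 < s) (hs1 : s < 1)
    (hr₁ : 2 * psi d s < r₁) (hw : ContDiffOn ℝ 1 w (Metric.ball 0 r₁))
    (θ : Metric.sphere (0 : Space d) 1) :
    ∫ q in (0 : ℝ)..(2 * psi d s), q ^ (d - 1) *
        (-(kernel d s ‖q • (θ : Space d)‖ / (2 * s) * fderiv ℝ w (q • (θ : Space d)) (q • θ)) +
          w (q • (θ : Space d)) * ((-(d / (2 * s) : ℝ) + ‖q • (θ : Space d)‖ ^ 2 / (4 * s ^ 2)) *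
            kernel d s ‖q • (θ : Space d)‖)) =
      -heatWeight d s * w ((2 * psi d s) • (θ : Space d)) := by
  set r := 2 * psi d s with hr
  have hr0 : 0 < r := two_mul_psi_pos hd hs hs1
  have hθ : ‖(θ : Space d)‖ = 1 := mem_sphere_zero_iff_norm.1 θ.2
  have hmem : ∀ q ∈ Icc 0 r, q • (θ : Space d) ∈ Metric.ball (0 : Space d) r₁ := by
    intro q hq
    rw [mem_ball_zero_iff, norm_smul, hθ, mul_one, Real.norm_eq_abs, abs_of_nonneg hq.1]
    exact hq.2.trans_lt hr₁
  have hwc : ContinuousOn w (Metric.ball 0 r₁) := hw.continuousOn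
  have hwd : ContinuousOn (fderiv ℝ w) (Metric.ball 0 r₁) :=
    hw.continuousOn_fderiv_of_isOpen Metric.isOpen_ball le_rfl
  have hray : ContinuousOn (fun q : ℝ => q • (θ : Space d)) (Icc 0 r) := by fun_prop
  have hk : Continuous fun q : ℝ => kernel d s q := by unfold kernel; fun_prop
  have hderiv : ∀ q ∈ Icc 0 r, HasDerivAt
      (fun q => -(1 / (2 * s)) * (q ^ d * (kernel d s q * w (q • (θ : Space d)))))
      (q ^ (d - 1) * (-(kernel d s q / (2 * s) * (q * fderiv ℝ w (q • (θ : Space d)) θ)) +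
        w (q • (θ : Space d)) * ((-(d / (2 * s) : ℝ) + q ^ 2 / (4 * s ^ 2)) * kernel d s q)))
      q := by
    intro q hq
    have h1 : HasDerivAt (fun q : ℝ => w (q • (θ : Space d)))
        (fderiv ℝ w (q • (θ : Space d)) θ) q := by
      have hd1 : DifferentiableAt ℝ w (q • (θ : Space d)) :=
        (hw.contDiffAt (Metric.isOpen_ball.mem_nhds (hmem q hq))).differentiableAt one_ne_zero
      have := hd1.hasFDerivAt.comp_hasDerivAt q ((hasDerivAt_id q).smul_const (θ : Space d))
      simpa [Function.comp_def] using! this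
    have h2 := ((hasDerivAt_pow d q).mul ((hasDerivAt_kernel_space (d := d) hs q).mul h1)).const_mul
      (-(1 / (2 * s)))
    convert! h2 using 1
    simp only [Pi.mul_apply]
    rw [← pow_sub_one_mul (Nat.one_le_iff_ne_zero.1 hd) q]
    field_simp
    ring
  have hcont : ContinuousOn (fun q : ℝ => q ^ (d - 1) *
      (-(kernel d s q / (2 * s) * (q * fderiv ℝ w (q • (θ : Space d)) θ)) +
        w (q • (θ : Space d)) * ((-(d / (2 * s) : ℝ) + q ^ 2 / (4 * s ^ 2)) * kernel d s q)))
      (Icc 0 r) := by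
    have h1 : ContinuousOn (fun q : ℝ => w (q • (θ : Space d))) (Icc 0 r) := hwc.comp hray hmem
    have h2 : ContinuousOn (fun q : ℝ => fderiv ℝ w (q • (θ : Space d)) θ) (Icc 0 r) :=
      (hwd.comp hray hmem).clm_apply continuousOn_const
    have h3 := hk.continuousOn (s := Icc 0 r)
    exact ContinuousOn.mul (by fun_prop) (ContinuousOn.add
      ((h3.div_const _).mul (continuousOn_id.mul h2)).neg
      (h1.mul (ContinuousOn.mul (by fun_prop) h3)))
  have key := intervalIntegral.integral_eq_sub_of_hasDerivAt
    (a := 0) (b := r) (fun q hq => hderiv q (by rwa [uIcc_of_le hr0.le] at hq))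
    (hcont.intervalIntegrable_of_Icc hr0.le)
  rw [show kernel d s r = 1 from kernel_two_mul_psi hs hs1.le,
    zero_pow (Nat.one_le_iff_ne_zero.1 hd)] at key
  have e : -(1 / (2 * s)) * (r ^ d * (1 * w (r • (θ : Space d)))) -
      -(1 / (2 * s)) * (0 * (kernel d s 0 * w ((0 : ℝ) • (θ : Space d)))) =
      -heatWeight d s * w (r • (θ : Space d)) := by
    rw [heatWeight]; ring
  rw [← e, ← key]
  refine intervalIntegral.integral_congr fun q hq => ?_
  rw [uIcc_of_le hr0.le] at hq
  have hn : ‖q • (θ : Space d)‖ = q := by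
    rw [norm_smul, hθ, mul_one, Real.norm_eq_abs, abs_of_nonneg hq.1]
  simp only [hn, map_smul, smul_eq_mul]

/-- The derivative of the integral against the truncated heat kernel only involves the values of `v`
on the boundary of the heat ball: in the interior the two terms of the derivative add up, by Green's
identity, to a radial derivative. -/
theorem hasDerivAt_heatIntegral' {d : ℕ} {r₁ : ℝ} {v : ℝ → Space d → ℝ} (hd : 1 ≤ d)
    (hr₁ : √(2 * d / Real.exp 1) < r₁) (hv : IsBackwardCaloric r₁ v) {s : ℝ}
    (hs : s ∈ Ioo (0 : ℝ) 1) :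
    HasDerivAt (heatIntegral r₁ v) (-heatWeight d s * ∫ θ : Metric.sphere (0 : Space d) 1,
      v s ((2 * psi d s) • (θ : Space d)) ∂(volume : Measure (Space d)).toSphere) s := by
  have hrr : 2 * psi d s < r₁ := (two_mul_psi_le hs.1.le hs.2.le).trans_lt hr₁
  have hw := hv.contDiffOn s hs
  have hw1 : ContDiffOn ℝ 1 (v s) (Metric.ball 0 r₁) := hw.of_le (by norm_num)
  have hint : ∀ f : Space d → ℝ, ContinuousOn f (Metric.ball 0 r₁) →
      IntegrableOn f (Metric.ball 0 (2 * psi d s)) := fun f hf =>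
    ((hf.mono (Metric.closedBall_subset_ball hrr)).integrableOn_compact
      (isCompact_closedBall _ _)).mono_set Metric.ball_subset_closedBall
  have hk := continuous_kernel_norm (d := d) s
  have hl : ContinuousOn (fun y => Laplacian.laplacian (v s) y) (Metric.ball 0 r₁) :=
    hv.continuousOn_laplacian.comp (f := fun y => (s, y)) (by fun_prop) fun _ hy => ⟨hs, hy⟩
  have h1 : ContinuousOn (fun y => Laplacian.laplacian (v s) y * (kernel d s ‖y‖ - 1))
      (Metric.ball 0 r₁) := hl.mul (hk.sub continuous_const).continuousOn
  have h2 : ContinuousOn (fun y => v s y * ((-(d / (2 * s) : ℝ) + ‖y‖ ^ 2 / (4 * s ^ 2)) *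
      kernel d s ‖y‖)) (Metric.ball 0 r₁) :=
    hw.continuousOn.mul (ContinuousOn.mul (by fun_prop) hk.continuousOn)
  have h3 : ContinuousOn (fun y => kernel d s ‖y‖ / (2 * s) * fderiv ℝ (v s) y y)
      (Metric.ball 0 r₁) :=
    (hk.div_const _).continuousOn.mul
      ((hw1.continuousOn_fderiv_of_isOpen Metric.isOpen_ball le_rfl).clm_apply continuousOn_id)
  have h4 : ContinuousOn (fun y => -(kernel d s ‖y‖ / (2 * s) * fderiv ℝ (v s) y y) +
      v s y * ((-(d / (2 * s) : ℝ) + ‖y‖ ^ 2 / (4 * s ^ 2)) * kernel d s ‖y‖))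
      (Metric.ball 0 r₁) := h3.neg.add h2
  convert! hasDerivAt_heatIntegral hd hr₁ hv hs using 1
  simp_rw [neg_mul (Laplacian.laplacian (v s) _)]
  rw [integral_add (f := fun y => -(Laplacian.laplacian (v s) y * (kernel d s ‖y‖ - 1)))
      (hint _ h1.neg) (hint _ h2), integral_neg,
    integral_laplacian_mul_kernel hd hs.1 hs.2 hrr hw, ← integral_neg,
    ← integral_add (f := fun y => -(kernel d s ‖y‖ / (2 * s) * fderiv ℝ (v s) y y))
      (hint _ h3.neg) (hint _ h2), integral_ball_eq_integral_sphere hd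
      (mul_nonneg zero_le_two (psi_nonneg d s)) (hint _ h4),
    ← integral_const_mul]
  exact integral_congr_ae (ae_of_all _ fun θ => (integral_ray hd hs.1 hs.2 hrr hw1 θ).symm)

theorem kernel_le_rpow {d : ℕ} {s : ℝ} (hs : 0 < s) (q : ℝ) :
    kernel d s q ≤ s ^ (-(d / 2 : ℝ)) := by
  refine mul_le_of_le_one_right (by positivity) ?_
  rw [Real.exp_le_one_iff, neg_div, neg_nonpos]
  positivity

theorem IsBackwardCaloric.exists_bound {d : ℕ} {r₁ : ℝ} {v : ℝ → Space d → ℝ}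
    (hv : IsBackwardCaloric r₁ v) :
    ∃ M, 0 ≤ M ∧ ∀ s ∈ Icc (0 : ℝ) 1, ∀ y ∈ Metric.closedBall (0 : Space d) r₁, |v s y| ≤ M := by
  obtain ⟨M, hM⟩ := (isCompact_Icc.prod
    (isCompact_closedBall (0 : Space d) r₁)).exists_bound_of_continuousOn hv.continuousOn
  exact ⟨max M 0, le_max_right _ _, fun s hs y hy => (hM (s, y) ⟨hs, hy⟩).trans (le_max_left _ _)⟩

theorem tendsto_heatIntegral_one {d : ℕ} {r₁ : ℝ} {v : ℝ → Space d → ℝ}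
    (hv : IsBackwardCaloric r₁ v) : Tendsto (heatIntegral r₁ v) (𝓝[<] 1) (𝓝 0) := by
  obtain ⟨M, hM0, hM⟩ := hv.exists_bound
  have hlim : Tendsto (fun s : ℝ => M * (s ^ (-(d / 2 : ℝ)) - 1) *
      (volume : Measure (Space d)).real (Metric.ball 0 r₁)) (𝓝[<] 1) (𝓝 0) := by
    have : ContinuousAt (fun s : ℝ => M * (s ^ (-(d / 2 : ℝ)) - 1) *
      (volume : Measure (Space d)).real (Metric.ball 0 r₁)) 1 := by
      refine ContinuousAt.mul (ContinuousAt.mul (by fun_prop) (ContinuousAt.sub ?_ (by fun_prop)))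
        (by fun_prop)
      exact Real.continuousAt_rpow_const _ _ (Or.inl one_ne_zero)
    simpa using this.tendsto.mono_left nhdsWithin_le_nhds
  refine squeeze_zero_norm' ?_ hlim
  filter_upwards [Ioo_mem_nhdsLT (zero_lt_one' ℝ)] with s hs
  have h1 : (1 : ℝ) ≤ s ^ (-(d / 2 : ℝ)) :=
    Real.one_le_rpow_of_pos_of_le_one_of_nonpos hs.1 hs.2.le (by
      have : (0 : ℝ) ≤ d / 2 := by positivity
      linarith)
  refine norm_setIntegral_le_of_norm_le_const measure_ball_lt_top fun y hy => ?_
  rw [Real.norm_eq_abs, abs_mul, abs_of_nonneg (le_max_right (kernel d s ‖y‖ - 1) 0)]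
  refine mul_le_mul (hM s (Ioo_subset_Icc_self hs) y (Metric.ball_subset_closedBall hy)) ?_
    (le_max_right _ _) hM0
  exact max_le (by linarith [kernel_le_rpow (d := d) hs.1 ‖y‖]) (by linarith)

theorem sqrt_pow_mul_kernel {d : ℕ} {s : ℝ} (hs : 0 < s) (z : Space d) :
    √s ^ d * kernel d s ‖√s • z‖ = Real.exp (-(1 / 4) * ‖z‖ ^ 2) := by
  have h1 : √s ^ d = s ^ (d / 2 : ℝ) := by
    rw [Real.sqrt_eq_rpow, ← Real.rpow_natCast, ← Real.rpow_mul hs.le]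
    congr 1; ring
  rw [kernel, ← mul_assoc, h1, ← Real.rpow_add hs, add_neg_cancel, Real.rpow_zero, one_mul,
    norm_smul, Real.norm_eq_abs, abs_of_nonneg (Real.sqrt_nonneg _), mul_pow, Real.sq_sqrt hs.le]
  congr 1
  field_simp

/-- As `s → 0` the heat kernel concentrates at the origin. -/
theorem tendsto_heatIntegral_zero {d : ℕ} {r₁ : ℝ} {v : ℝ → Space d → ℝ} (hd : 1 ≤ d)
    (hr₁ : 0 < r₁)
    (hv : IsBackwardCaloric r₁ v) : Tendsto (heatIntegral r₁ v) (𝓝[>] 0)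
      (𝓝 ((∫ z : Space d, Real.exp (-(1 / 4) * ‖z‖ ^ 2)) * v 0 0)) := by
  obtain ⟨M, hM0, hM⟩ := hv.exists_bound
  -- the substitution `y = √s z` turns the kernel into a fixed Gaussian
  set F : ℝ → Space d → ℝ := fun s z => √s ^ d * (Metric.ball (0 : Space d) r₁).indicator
    (fun y => v s y * max (kernel d s ‖y‖ - 1) 0) (√s • z) with hF
  have e1 : heatIntegral r₁ v =ᶠ[𝓝[>] 0] fun s => ∫ z, F s z := by
    filter_upwards [self_mem_nhdsWithin] with s hs
    have hs' : (0 : ℝ) < √s := Real.sqrt_pos.2 hs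
    rw [heatIntegral, ← integral_indicator measurableSet_ball, hF]
    simp only
    rw [integral_const_mul, Measure.integral_comp_smul_of_nonneg volume _ _ (hR := hs'.le),
      finrank_euclideanSpace_fin, smul_eq_mul, mul_inv_cancel_left₀ (by positivity)]
  rw [← integral_mul_const]
  refine Tendsto.congr' e1.symm ?_
  have hev : ∀ᶠ s : ℝ in 𝓝[>] 0, s ∈ Ioo (0 : ℝ) 1 := Ioo_mem_nhdsGT zero_lt_one
  refine tendsto_integral_filter_of_dominated_convergence
    (fun z => M * Real.exp (-(1 / 4) * ‖z‖ ^ 2)) ?_ ?_ ?_ (ae_of_all _ fun z => ?_)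
  · filter_upwards [hev] with s hs
    have hcont : ContinuousOn (fun y => v s y * max (kernel d s ‖y‖ - 1) 0)
        (Metric.ball 0 r₁) := ((hv.continuousOn_slice (Ioo_subset_Icc_self hs)).mono
          Metric.ball_subset_closedBall).mul
      (((continuous_kernel_norm s).sub continuous_const).max continuous_const).continuousOn
    have hmeas : Measurable ((Metric.ball (0 : Space d) r₁).indicator
        (fun y => v s y * max (kernel d s ‖y‖ - 1) 0)) := by
      classical
      have := hcont.measurable_piecewise (g := (0 : Space d → ℝ)) continuous_zero.continuousOn
        measurableSet_ball
      rwa [piecewise_eq_indicator] at this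
    exact ((hmeas.comp (measurable_const_smul (√s))).const_mul _).aestronglyMeasurable
  · filter_upwards [hev] with s hs
    refine ae_of_all _ fun z => ?_
    rw [← sqrt_pow_mul_kernel hs.1 z]
    simp only [hF]
    by_cases hz : √s • z ∈ Metric.ball (0 : Space d) r₁
    · rw [indicator_of_mem hz, Real.norm_eq_abs, abs_mul, abs_mul,
        abs_of_nonneg (le_max_right (kernel d s ‖√s • z‖ - 1) 0),
        abs_of_nonneg (by positivity : 0 ≤ √s ^ d),
        mul_left_comm]
      have := kernel_pos (d := d) hs.1 ‖√s • z‖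
      refine mul_le_mul (hM s (Ioo_subset_Icc_self hs) _ (Metric.ball_subset_closedBall hz)) ?_
        (by positivity) hM0
      gcongr
      exact max_le (by linarith) this.le
    · rw [indicator_of_notMem hz, mul_zero, norm_zero]
      have := kernel_pos (d := d) hs.1 ‖√s • z‖
      positivity
  · exact (GaussianFourier.integrable_cexp_neg_mul_sq_norm_add (V := Space d) (b := 1 / 4)
      (by norm_num) 0 0).norm.congr (ae_of_all _ fun z => by
        simp [Complex.norm_exp, ← Complex.ofReal_pow]) |>.const_mul M
  · have hsq : Tendsto (fun s : ℝ => √s • z) (𝓝[>] 0) (𝓝 0) := by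
      have : Continuous fun s : ℝ => √s • z := by fun_prop
      simpa using (this.tendsto 0).mono_left nhdsWithin_le_nhds
    have hball : ∀ᶠ s : ℝ in 𝓝[>] 0, √s • z ∈ Metric.ball (0 : Space d) r₁ :=
      hsq.eventually (Metric.ball_mem_nhds _ hr₁)
    have hvlim : Tendsto (fun s : ℝ => v s (√s • z)) (𝓝[>] 0) (𝓝 (v 0 0)) := by
      have h0 : ((0 : ℝ), (0 : Space d)) ∈ Icc (0 : ℝ) 1 ×ˢ Metric.closedBall (0 : Space d) r₁ :=
        ⟨⟨le_rfl, zero_le_one⟩, by simpa using hr₁.le⟩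
      refine (hv.continuousOn _ h0).tendsto.comp (tendsto_nhdsWithin_iff.2
        ⟨(tendsto_nhdsWithin_of_tendsto_nhds tendsto_id).prodMk_nhds hsq, ?_⟩)
      filter_upwards [hev, hball] with s hs hb
      exact ⟨Ioo_subset_Icc_self hs, Metric.ball_subset_closedBall hb⟩
    have hklim : Tendsto (fun s : ℝ => max (Real.exp (-(1 / 4) * ‖z‖ ^ 2) - √s ^ d) 0) (𝓝[>] 0)
        (𝓝 (max (Real.exp (-(1 / 4) * ‖z‖ ^ 2) - √0 ^ d) 0)) := by
      have : Continuous fun s : ℝ => max (Real.exp (-(1 / 4) * ‖z‖ ^ 2) - √s ^ d) 0 := by fun_prop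
      exact (this.tendsto 0).mono_left nhdsWithin_le_nhds
    rw [Real.sqrt_zero, zero_pow (Nat.one_le_iff_ne_zero.1 hd), sub_zero,
      max_eq_left (Real.exp_pos _).le] at hklim
    rw [mul_comm]
    refine (hvlim.mul hklim).congr' ?_
    filter_upwards [hev, hball] with s hs hb
    simp only [hF]
    rw [indicator_of_mem hb, mul_left_comm, ← sqrt_pow_mul_kernel hs.1 z,
      mul_max_of_nonneg _ _ (by positivity : 0 ≤ √s ^ d), mul_zero, mul_sub_one]

theorem continuousOn_psi (d : ℕ) : ContinuousOn (psi d) (Icc 0 1) := by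
  have h : ContinuousOn (fun s : ℝ => √(-(d / 2) * (s * Real.log s))) (Icc 0 1) :=
    (Real.continuous_sqrt.comp (continuous_const.mul Real.continuous_mul_log)).continuousOn
  refine h.congr fun s hs => ?_
  rcases hs.1.eq_or_lt with rfl | h0
  · simp [psi]
  · rw [psi, Real.log_rpow h0]
    congr 1; ring

/-- The average of `v` over the boundary of a time slice of the unit heat ball is continuous in
time, up to both ends of the heat ball. -/
theorem continuousOn_integral_sphere {d : ℕ} {r₁ : ℝ} {v : ℝ → Space d → ℝ}
    (hr₁ : √(2 * d / Real.exp 1) ≤ r₁)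
    (hv : ContinuousOn (fun p : ℝ × Space d => v p.1 p.2) (Icc 0 1 ×ˢ Metric.closedBall 0 r₁))
    (μ : Measure (Metric.sphere (0 : Space d) 1)) [IsFiniteMeasure μ] :
    ContinuousOn (fun s => ∫ θ, v s ((2 * psi d s) • (θ : Space d)) ∂μ) (Icc 0 1) := by
  obtain ⟨M, hM⟩ := (isCompact_Icc.prod
    (isCompact_closedBall (0 : Space d) r₁)).exists_bound_of_continuousOn hv
  have hmem : ∀ s ∈ Icc (0 : ℝ) 1, ∀ θ : Metric.sphere (0 : Space d) 1,
      (s, (2 * psi d s) • (θ : Space d)) ∈ Icc (0 : ℝ) 1 ×ˢ Metric.closedBall (0 : Space d) r₁ := by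
    intro s hs θ
    refine ⟨hs, ?_⟩
    rw [mem_closedBall_zero_iff, norm_smul, mem_sphere_zero_iff_norm.1 θ.2, mul_one,
      Real.norm_eq_abs, abs_of_nonneg (mul_nonneg zero_le_two (psi_nonneg d s))]
    exact (two_mul_psi_le hs.1 hs.2).trans hr₁
  refine continuousOn_of_dominated (bound := fun _ => M) (fun s hs => ?_) (fun s hs => ?_)
    (integrable_const M) (ae_of_all _ fun θ => ?_)
  · have : Continuous fun θ : Metric.sphere (0 : Space d) 1 =>
        v s ((2 * psi d s) • (θ : Space d)) :=
      hv.comp_continuous (f := fun θ : Metric.sphere (0 : Space d) 1 =>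
        (s, (2 * psi d s) • (θ : Space d))) (by fun_prop) (hmem s hs)
    exact this.aestronglyMeasurable
  · exact ae_of_all _ fun θ => hM _ (hmem s hs θ)
  · have hp := continuousOn_psi d
    exact hv.comp (f := fun s => (s, (2 * psi d s) • (θ : Space d))) (by fun_prop)
      fun s hs => hmem s hs θ

/-- The derivative of `heatIntegral` integrated over `(0,1)`: the mean value formula on the unit
heat ball, not yet normalised. -/
theorem integral_heatWeight_mul_sphere {d : ℕ} {r₁ : ℝ} {v : ℝ → Space d → ℝ} (hd : 1 ≤ d)
    (hr₁ : √(2 * d / Real.exp 1) < r₁) (hv : IsBackwardCaloric r₁ v) :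
    ∫ s in Ioo (0 : ℝ) 1, heatWeight d s * ∫ θ : Metric.sphere (0 : Space d) 1,
      v s ((2 * psi d s) • (θ : Space d)) ∂(volume : Measure (Space d)).toSphere =
      (∫ z : Space d, Real.exp (-(1 / 4) * ‖z‖ ^ 2)) * v 0 0 := by
  have hr₁0 : 0 < r₁ := (Real.sqrt_nonneg _).trans_lt hr₁
  have hg := continuousOn_integral_sphere hr₁.le hv.continuousOn
    (volume : Measure (Space d)).toSphere
  obtain ⟨M, hM⟩ := isCompact_Icc.exists_bound_of_continuousOn hg
  have hint : IntegrableOn (fun s => heatWeight d s * ∫ θ : Metric.sphere (0 : Space d) 1,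
      v s ((2 * psi d s) • (θ : Space d)) ∂(volume : Measure (Space d)).toSphere) (Ioo 0 1) :=
    (integrableOn_heatWeight hd).mul_bdd
      ((hg.mono Ioo_subset_Icc_self).aestronglyMeasurable measurableSet_Ioo)
      ((ae_restrict_mem measurableSet_Ioo).mono fun s hs => hM s (Ioo_subset_Icc_self hs))
  have key := intervalIntegral.integral_eq_sub_of_hasDerivAt_of_tendsto zero_lt_one
    (fun s hs => hasDerivAt_heatIntegral' hd hr₁ hv hs) ?_
    (tendsto_heatIntegral_zero hd hr₁0 hv) (tendsto_heatIntegral_one hv)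
  · rw [intervalIntegral.integral_of_le zero_le_one, integral_Ioc_eq_integral_Ioo] at key
    simp_rw [neg_mul] at key
    rw [integral_neg, zero_sub, neg_inj] at key
    simpa only [neg_mul] using key
  · rw [intervalIntegrable_iff_integrableOn_Ioo_of_le zero_le_one]
    simp only [neg_mul]
    exact hint.neg

theorem isBackwardCaloric_one {d : ℕ} (r₁ : ℝ) : IsBackwardCaloric (d := d) r₁ fun _ _ => 1 where
  continuousOn := continuousOn_const
  hasDerivAt s _ y _ := by
    have : Laplacian.laplacian (fun _ : Space d => (1 : ℝ)) = 0 :=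
      InnerProductSpace.laplacian_const
    rw [this]
    simpa using hasDerivAt_const s (1 : ℝ)
  contDiffOn _ _ := contDiffOn_const
  continuousOn_laplacian := by
    have : Laplacian.laplacian (fun _ : Space d => (1 : ℝ)) = 0 :=
      InnerProductSpace.laplacian_const
    rw [this]
    exact continuousOn_const

theorem isProbabilityMeasure_uniformSphere {d : ℕ} (hd : 1 ≤ d) :
    IsProbabilityMeasure (uniformSphere d) := by
  have : Nonempty (Fin d) := ⟨⟨0, hd⟩⟩
  have : Nontrivial (Space d) := by
    refine ⟨⟨0, EuclideanSpace.single ⟨0, hd⟩ 1, fun h => ?_⟩⟩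
    have := congrArg (fun x : Space d => x ⟨0, hd⟩) h
    simp at this
  have hne : (volume : Measure (Space d)).toSphere univ ≠ 0 :=
    Measure.measure_univ_ne_zero.2 (Measure.toSphere_ne_zero _)
  exact ⟨by rw [uniformSphere, Measure.smul_apply, smul_eq_mul,
    ENNReal.inv_mul_cancel hne (measure_ne_top _ _)]⟩

theorem integral_uniformSphere {d : ℕ} (f : Metric.sphere (0 : Space d) 1 → ℝ) :
    ∫ θ, f θ ∂uniformSphere d =
      ((volume : Measure (Space d)).toSphere.real univ)⁻¹ *
        ∫ θ, f θ ∂(volume : Measure (Space d)).toSphere := by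
  rw [uniformSphere, integral_smul_measure, ENNReal.toReal_inv, smul_eq_mul]
  rfl

/-- Mean value formula on the unit heat ball. The normalising constants are not computed: they are
the same for `v` and for the constant `1`. -/
theorem IsBackwardCaloric.mean_value {d : ℕ} {r₁ : ℝ} {v : ℝ → Space d → ℝ} (hd : 1 ≤ d)
    (hr₁ : √(2 * d / Real.exp 1) < r₁) (hv : IsBackwardCaloric r₁ v) :
    ∫ p, (∫ θ : Metric.sphere (0 : Space d) 1, v (radial d p.1 p.2)
      ((2 * psi d (radial d p.1 p.2)) • (θ : Space d)) ∂uniformSphere d) ∂radialNoise d =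
      v 0 0 := by
  have := isProbabilityMeasure_uniformSphere hd
  have h1 := integral_radial_mul_integral_heatWeight hd
    (continuousOn_integral_sphere hr₁.le hv.continuousOn (uniformSphere d))
  have hW := integral_heatWeight_pos hd
  set S := (volume : Measure (Space d)).toSphere with hS
  set Z := ∫ z : Space d, Real.exp (-(1 / 4) * ‖z‖ ^ 2) with hZ
  have h2 : (∫ s in Ioo (0 : ℝ) 1, heatWeight d s) * S.real univ = Z := by
    have := integral_heatWeight_mul_sphere hd hr₁ (isBackwardCaloric_one (d := d) r₁)
    simp only [integral_const, smul_eq_mul, mul_one] at this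
    rwa [integral_mul_const] at this
  have hSne : S.real univ ≠ 0 := by
    have : uniformSphere d univ = 1 := measure_univ
    intro h
    rw [measureReal_eq_zero_iff] at h
    rw [uniformSphere, Measure.smul_apply, ← hS, h] at this
    simp at this
  simp only [integral_uniformSphere, mul_left_comm (heatWeight d _), integral_const_mul] at h1 ⊢
  rw [integral_heatWeight_mul_sphere hd hr₁ hv, ← hZ, ← h2] at h1
  simp only [← hS] at h1 ⊢
  refine mul_right_cancel₀ hW.ne' (h1.trans ?_)
  field_simp

/-! ### The mean value property of a solution -/

/-- The ball is connected and does not meet the frontier, so it cannot leave the open set. -/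
theorem ball_bdist_subset {d : ℕ} {D : Set (Space d)} (hDo : IsOpen D) {x : Space d} (hx : x ∈ D) :
    Metric.ball x (bdist D x) ⊆ D := by
  rcases le_or_gt (bdist D x) 0 with hr | hr
  · rw [Metric.ball_eq_empty.2 hr]
    exact empty_subset _
  refine (convex_ball x _).isPreconnected.subset_left_of_subset_union hDo
    isClosed_closure.isOpen_compl (disjoint_compl_right.mono_right (compl_subset_compl.2
      subset_closure)) (fun y hy => ?_) ⟨x, Metric.mem_ball_self hr, hx⟩
  by_contra h
  rw [mem_union, not_or, notMem_compl_iff] at h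
  have hyf : y ∈ frontier D := by rw [hDo.frontier_eq]; exact ⟨h.2, h.1⟩
  have h1 := Metric.infDist_le_dist_of_mem (x := x) hyf
  rw [Metric.mem_ball, dist_comm] at hy
  exact absurd hy (not_lt.2 h1)

theorem closedBall_bdist_subset {d : ℕ} {D : Set (Space d)} (hDo : IsOpen D) {x : Space d}
    (hx : x ∈ D) (h : 0 < bdist D x) :
    Metric.closedBall x (bdist D x) ⊆ closure D := by
  rw [← closure_ball x h.ne']
  exact closure_mono (ball_bdist_subset hDo hx)

theorem mem_of_bdist_pos {d : ℕ} {D : Set (Space d)} (hDo : IsOpen D) {x : Space d}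
    (hx : x ∈ closure D) (h : 0 < bdist D x) : x ∈ D := by
  by_contra hxD
  have : x ∈ frontier D := by rw [hDo.frontier_eq]; exact ⟨hx, hxD⟩
  rw [bdist, Metric.infDist_zero_of_mem this] at h
  exact lt_irrefl _ h

theorem alpha_nonneg {d : ℕ} (D : Set (Space d)) {z : ℝ × Space d} (h : 0 ≤ z.1) :
    0 ≤ alpha D z := le_min h (by positivity)

/-- The heat ball of size `a ≤ α(z)` has spatial radius at most `δ(z.2, ∂D)`. -/
theorem sqrt_mul_le_bdist {d : ℕ} (hd : 1 ≤ d) {D : Set (Space d)} {z : ℝ × Space d} {a : ℝ}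
    (ha : a ≤ alpha D z) : √a * √(2 * d / Real.exp 1) ≤ bdist D z.2 := by
  have hd0 : (0 : ℝ) < d := by exact_mod_cast hd
  have hδ : 0 ≤ bdist D z.2 := Metric.infDist_nonneg
  rw [← Real.sqrt_mul' _ (by positivity)]
  refine Real.sqrt_le_iff.2 ⟨hδ, ?_⟩
  have h := ha.trans (min_le_right _ _)
  calc a * (2 * d / Real.exp 1)
      ≤ Real.exp 1 / (2 * d) * bdist D z.2 ^ 2 * (2 * d / Real.exp 1) := by gcongr
    _ = bdist D z.2 ^ 2 := by field_simp

/-- One step of the walk with step size `a`. -/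
def move {d : ℕ} (a R : ℝ) (θ : Space d) (z : ℝ × Space d) : ℝ × Space d :=
  (z.1 - a * R, z.2 + (2 * √a * psi d R) • θ)

theorem move_mem {d : ℕ} (hd : 1 ≤ d) {D : Set (Space d)} (hDo : IsOpen D) {T : ℝ}
    {z : ℝ × Space d} (hz : z ∈ Icc 0 T ×ˢ closure D) {a R : ℝ} (ha0 : 0 ≤ a)
    (ha : a ≤ alpha D z) (hR : R ∈ Icc (0 : ℝ) 1) {θ : Space d} (hθ : ‖θ‖ = 1) :
    move a R θ z ∈ Icc 0 T ×ˢ closure D := by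
  rcases ha0.eq_or_lt with rfl | ha0'
  · simpa [move] using hz
  have haT : a ≤ z.1 := ha.trans (min_le_left _ _)
  refine ⟨⟨?_, ?_⟩, ?_⟩
  · simp only [move]
    nlinarith [hR.1, hR.2]
  · simp only [move]
    nlinarith [hz.1.2, hR.1]
  · have hd0 : (0 : ℝ) < d := by exact_mod_cast hd
    have h1 := sqrt_mul_le_bdist hd ha
    have hδ : 0 < bdist D z.2 := lt_of_lt_of_le (by positivity) h1
    refine closedBall_bdist_subset hDo (mem_of_bdist_pos hDo hz.2 hδ) hδ ?_
    have hψ := psi_nonneg d R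
    rw [move, Metric.mem_closedBall, dist_self_add_left, norm_smul, hθ, mul_one, Real.norm_eq_abs,
      abs_of_nonneg (by positivity)]
    refine le_trans ?_ h1
    rw [mul_comm 2, mul_assoc]
    gcongr
    exact two_mul_psi_le hR.1 hR.2

theorem laplacian_comp_affine {d : ℕ} (w : Space d → ℝ) (x : Space d) (c : ℝ) (y : Space d) :
    Laplacian.laplacian (fun y => w (x + c • y)) y = c ^ 2 * Laplacian.laplacian w (x + c • y) := by
  have h1 : ∀ (E : Type) [NormedAddCommGroup E] [NormedSpace ℝ E] (g : Space d → E) (y : Space d),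
      fderiv ℝ (fun y => g (x + c • y)) y = c • fderiv ℝ g (x + c • y) := by
    intro E _ _ g y
    have := fderiv_comp_smul (𝕜 := ℝ) (f := fun y => g (x + y)) (x := y) c
    rw [this, fderiv_comp_add_left]
  rw [laplacian_eq_sum, laplacian_eq_sum, Finset.mul_sum]
  refine Finset.sum_congr rfl fun i _ => ?_
  have h2 : fderiv ℝ (fun y => w (x + c • y)) = fun y => c • fderiv ℝ w (x + c • y) :=
    funext fun y => h1 ℝ w y
  rw [h2]
  have h3 := h1 _ (fun z => c • fderiv ℝ w z) y
  rw [h3]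
  rcases eq_or_ne c 0 with rfl | hc
  · simp
  · have := invertibleOfNonzero hc
    have h4 := fderiv_const_smul_of_invertible (𝕜 := ℝ) (f := fderiv ℝ w) (x := x + c • y) c
    rw [show (fun z => c • fderiv ℝ w z) = c • fderiv ℝ w from rfl, h4]
    simp only [_root_.smul_apply, smul_eq_mul]
    ring

/-- A solution seen backwards in time from the point `z`, at a parabolic scale `a ≤ α(z)`. -/
theorem IsSolution.isBackwardCaloric {d : ℕ} {D : Set (Space d)} (hDo : IsOpen D)
    {T : ℝ} {f : ℝ → Space d → ℝ} {f₀ : Space d → ℝ} {u : ℝ → Space d → ℝ}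
    (hu : IsSolution D T f f₀ u) {z : ℝ × Space d} (hz : z ∈ Icc 0 T ×ˢ closure D) {a : ℝ}
    (ha0 : 0 < a) (ha : a ≤ alpha D z) (hδ : 0 < bdist D z.2) :
    IsBackwardCaloric (bdist D z.2 / √a) fun s y => u (z.1 - a * s) (z.2 + √a • y) := by
  have hzD := mem_of_bdist_pos hDo hz.2 hδ
  have haT : a ≤ z.1 := ha.trans (min_le_left _ _)
  have hsa : 0 < √a := Real.sqrt_pos.2 ha0
  have htime : ∀ s ∈ Icc (0 : ℝ) 1, z.1 - a * s ∈ Icc 0 T := fun s hs =>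
    ⟨by nlinarith [hs.2], by nlinarith [hs.1, hz.1.2]⟩
  have htime' : ∀ s ∈ Ioo (0 : ℝ) 1, z.1 - a * s ∈ Ioo 0 T := fun s hs =>
    ⟨by nlinarith [hs.2], by nlinarith [hs.1, hz.1.2]⟩
  have hball : ∀ y ∈ Metric.ball (0 : Space d) (bdist D z.2 / √a), z.2 + √a • y ∈ D := by
    intro y hy
    refine ball_bdist_subset hDo hzD ?_
    rw [mem_ball_zero_iff, lt_div_iff₀ hsa] at hy
    rw [Metric.mem_ball, dist_self_add_left, norm_smul, Real.norm_eq_abs, abs_of_pos hsa, mul_comm]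
    exact hy
  have hcball : ∀ y ∈ Metric.closedBall (0 : Space d) (bdist D z.2 / √a),
      z.2 + √a • y ∈ closure D := by
    intro y hy
    refine closedBall_bdist_subset hDo hzD hδ ?_
    rw [mem_closedBall_zero_iff, le_div_iff₀ hsa] at hy
    rw [Metric.mem_closedBall, dist_self_add_left, norm_smul, Real.norm_eq_abs, abs_of_pos hsa,
      mul_comm]
    exact hy
  have hlap : ∀ s ∈ Ioo (0 : ℝ) 1, ∀ y ∈ Metric.ball (0 : Space d) (bdist D z.2 / √a),
      Laplacian.laplacian (fun y => u (z.1 - a * s) (z.2 + √a • y)) y =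
        a * deriv (fun τ => u τ (z.2 + √a • y)) (z.1 - a * s) := by
    intro s hs y hy
    rw [laplacian_comp_affine (u (z.1 - a * s)), Real.sq_sqrt ha0.le,
      hu.heat _ (htime' s hs) _ (hball y hy)]
  refine ⟨?_, fun s hs y hy => ?_, fun s hs => ?_, ?_⟩
  · exact hu.continuous_closure.comp
      (f := fun p : ℝ × Space d => (z.1 - a * p.1, z.2 + √a • p.2)) (by fun_prop)
      fun p hp => ⟨htime _ hp.1, hcball _ hp.2⟩
  · rw [hlap s hs y hy]
    have h1 := (hu.isC12.differentiable_time _ (htime' s hs) _ (hball y hy)).hasDerivAt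
    have h2 : HasDerivAt (fun s => z.1 - a * s) (-a) s := by
      simpa using ((hasDerivAt_id s).const_mul a).const_sub z.1
    convert! h1.comp s h2 using 1
    ring
  · exact (hu.isC12.contDiff_space _ (htime' s hs)).comp (by fun_prop) fun y hy => hball y hy
  · refine ContinuousOn.congr (f := fun p : ℝ × Space d =>
      a * deriv (fun τ => u τ (z.2 + √a • p.2)) (z.1 - a * p.1)) ?_
      fun p hp => hlap _ hp.1 _ hp.2
    refine continuousOn_const.mul ?_
    exact hu.isC12.continuous_deriv_time.comp
      (f := fun p : ℝ × Space d => (z.1 - a * p.1, z.2 + √a • p.2)) (by fun_prop)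
      fun p hp => ⟨htime' _ hp.1, hball _ hp.2⟩

/-- The function `u` on the cylinder `[0,T] × closure D`, extended by zero so as to be measurable
everywhere. -/
def extension {d : ℕ} (D : Set (Space d)) (T : ℝ) (u : ℝ → Space d → ℝ) : ℝ × Space d → ℝ :=
  (Icc 0 T ×ˢ closure D).indicator fun p => u p.1 p.2

theorem extension_of_mem {d : ℕ} {D : Set (Space d)} {T : ℝ} (u : ℝ → Space d → ℝ)
    {z : ℝ × Space d} (hz : z ∈ Icc 0 T ×ˢ closure D) : extension D T u z = u z.1 z.2 :=
  indicator_of_mem hz _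

theorem measurable_extension {d : ℕ} {D : Set (Space d)} {T : ℝ} {u : ℝ → Space d → ℝ}
    (hu : ContinuousOn (fun p : ℝ × Space d => u p.1 p.2) (Icc 0 T ×ˢ closure D)) :
    Measurable (extension D T u) := by
  classical
  have := hu.measurable_piecewise (g := (0 : ℝ × Space d → ℝ)) continuous_zero.continuousOn
    (measurableSet_Icc.prod isClosed_closure.measurableSet)
  rwa [piecewise_eq_indicator] at this

theorem exists_bound_extension {d : ℕ} {D : Set (Space d)} (hDb : Bornology.IsBounded D) {T : ℝ}
    {u : ℝ → Space d → ℝ}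
    (hu : ContinuousOn (fun p : ℝ × Space d => u p.1 p.2) (Icc 0 T ×ˢ closure D)) :
    ∃ M, ∀ z, ‖extension D T u z‖ ≤ M := by
  obtain ⟨M, hM⟩ := (isCompact_Icc.prod hDb.isCompact_closure).exists_bound_of_continuousOn hu
  refine ⟨max M 0, fun z => ?_⟩
  by_cases hz : z ∈ Icc 0 T ×ˢ closure D
  · rw [extension_of_mem u hz]
    exact (hM z hz).trans (le_max_left _ _)
  · rw [extension, indicator_of_notMem hz, norm_zero]
    exact le_max_right _ _

/-- The space of values of the variables `((U, G), V)` driving one step of the walk. -/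
abbrev StepNoise (d : ℕ) : Type :=
  ((Fin (d / 2 + 1) → ℝ) × ℝ) × Metric.sphere (0 : Space d) 1

/-- The joint law of the variables driving one step of the walk. -/
def stepLaw (d : ℕ) : Measure (StepNoise d) :=
  (radialNoise d).prod (uniformSphere d)

theorem isProbabilityMeasure_stepLaw {d : ℕ} (hd : 1 ≤ d) : IsProbabilityMeasure (stepLaw d) := by
  have := isProbabilityMeasure_uniformSphere hd
  unfold stepLaw
  infer_instance

theorem ae_stepLaw_radial_mem {d : ℕ} (hd : 1 ≤ d) :
    ∀ᵐ ξ ∂stepLaw d, radial d ξ.1.1 ξ.1.2 ∈ Icc (0 : ℝ) 1 := by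
  have := isProbabilityMeasure_uniformSphere hd
  exact Measure.quasiMeasurePreserving_fst.ae (ae_radial_mem_Icc d)

/-- The step of the walk from `z`, with step size `a` and the noise `ξ`. -/
def noiseMove {d : ℕ} (a : ℝ) (ξ : StepNoise d) (z : ℝ × Space d) : ℝ × Space d :=
  move a (radial d ξ.1.1 ξ.1.2) ξ.2 z

theorem measurable_noiseMove (d : ℕ) :
    Measurable fun p : (ℝ × (ℝ × Space d)) × StepNoise d => noiseMove p.1.1 p.2 p.1.2 := by
  have h1 : Measurable fun p : (ℝ × (ℝ × Space d)) × StepNoise d => radial d p.2.1.1 p.2.1.2 :=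
    (measurable_radial d).comp (by fun_prop)
  have h2 := (measurable_psi d).comp h1
  have h3 : Measurable fun p : (ℝ × (ℝ × Space d)) × StepNoise d => (p.2.2 : Space d) :=
    measurable_subtype_coe.comp (by fun_prop)
  unfold noiseMove move
  refine Measurable.prodMk (by fun_prop) (Measurable.add (by fun_prop)
    (Measurable.fun_smul ?_ h3))
  exact Measurable.mul (by fun_prop) h2

/-- Mean value property on heat balls strictly inside the domain. -/
theorem IsSolution.mean_value_of_lt {d : ℕ} (hd : 1 ≤ d) {D : Set (Space d)} (hDo : IsOpen D)
    (hDb : Bornology.IsBounded D) {T : ℝ} {f : ℝ → Space d → ℝ} {f₀ : Space d → ℝ}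
    {u : ℝ → Space d → ℝ} (hu : IsSolution D T f f₀ u) {z : ℝ × Space d}
    (hz : z ∈ Icc 0 T ×ˢ closure D) {a : ℝ} (ha0 : 0 < a) (ha : a < alpha D z) :
    ∫ ξ, extension D T u (noiseMove a ξ z) ∂stepLaw d = u z.1 z.2 := by
  have := isProbabilityMeasure_stepLaw hd
  have := isProbabilityMeasure_uniformSphere hd
  have hd0 : (0 : ℝ) < d := by exact_mod_cast hd
  have hsa : 0 < √a := Real.sqrt_pos.2 ha0
  have hr : √(2 * d / Real.exp 1) < bdist D z.2 / √a := by
    rw [lt_div_iff₀ hsa, mul_comm]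
    refine lt_of_lt_of_le ?_ (sqrt_mul_le_bdist hd (z := z) le_rfl)
    gcongr
  have hδ : 0 < bdist D z.2 :=
    lt_of_lt_of_le (by positivity) (sqrt_mul_le_bdist hd (z := z) ha.le)
  have key := (hu.isBackwardCaloric hDo hz ha0 ha.le hδ).mean_value hd hr
  obtain ⟨M, hM⟩ := exists_bound_extension hDb hu.continuous_closure
  have hmeas : Measurable fun ξ => extension D T u (noiseMove a ξ z) :=
    (measurable_extension hu.continuous_closure).comp
      ((measurable_noiseMove d).comp ((measurable_const (a := (a, z))).prodMk measurable_id))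
  have hint : Integrable (fun ξ => extension D T u (noiseMove a ξ z)) (stepLaw d) :=
    Integrable.of_bound hmeas.aestronglyMeasurable M (ae_of_all _ fun ξ => hM _)
  rw [stepLaw] at hint ⊢
  rw [integral_prod _ hint]
  simp only [mul_zero, sub_zero, smul_zero, add_zero] at key
  rw [← key]
  refine integral_congr_ae ?_
  filter_upwards [ae_radial_mem_Icc d] with p hp
  refine integral_congr_ae (ae_of_all _ fun θ => ?_)
  have hmem := move_mem hd hDo hz ha0.le ha.le hp (mem_sphere_zero_iff_norm.1 θ.2)
  simp only [noiseMove]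
  rw [extension_of_mem u hmem]
  simp only [move, smul_smul]
  rw [mul_left_comm (√a), mul_assoc]

/-- Mean value property on heat balls: the solution is harmonic for the walk. The full step size
`α(z)`, for which the heat ball may touch the parabolic boundary, is reached by continuity. -/
theorem IsSolution.mean_value {d : ℕ} (hd : 1 ≤ d) {D : Set (Space d)} (hDo : IsOpen D)
    (hDb : Bornology.IsBounded D) {T : ℝ} {f : ℝ → Space d → ℝ} {f₀ : Space d → ℝ}
    {u : ℝ → Space d → ℝ} (hu : IsSolution D T f f₀ u) {z : ℝ × Space d}
    (hz : z ∈ Icc 0 T ×ˢ closure D) :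
    ∫ ξ, extension D T u (noiseMove (alpha D z) ξ z) ∂stepLaw d = extension D T u z := by
  have := isProbabilityMeasure_stepLaw hd
  rw [extension_of_mem u hz]
  rcases (alpha_nonneg D hz.1.1).eq_or_lt with h0 | hpos
  · simp [← h0, noiseMove, move, extension_of_mem u hz]
  obtain ⟨M, hM⟩ := exists_bound_extension hDb hu.continuous_closure
  have hmeas : ∀ a, Measurable fun ξ => extension D T u (noiseMove a ξ z) := fun a =>
    (measurable_extension hu.continuous_closure).comp
      ((measurable_noiseMove d).comp ((measurable_const (a := (a, z))).prodMk measurable_id))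
  have hcont : ContinuousOn (fun a => ∫ ξ, extension D T u (noiseMove a ξ z) ∂stepLaw d)
      (Icc 0 (alpha D z)) := by
    refine continuousOn_of_dominated (bound := fun _ => M)
      (fun a _ => (hmeas a).aestronglyMeasurable) (fun a _ => ae_of_all _ fun ξ => hM _)
      (integrable_const M) ?_
    filter_upwards [ae_stepLaw_radial_mem hd] with ξ hξ
    have hmem : ∀ a ∈ Icc 0 (alpha D z), noiseMove a ξ z ∈ Icc 0 T ×ˢ closure D := fun a ha =>
      move_mem hd hDo hz ha.1 ha.2 hξ (mem_sphere_zero_iff_norm.1 ξ.2.2)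
    refine ContinuousOn.congr (hu.continuous_closure.comp
      (f := fun a => noiseMove a ξ z) ?_ hmem) fun a ha => extension_of_mem u (hmem a ha)
    unfold noiseMove move
    fun_prop
  have heq : EqOn (fun a => ∫ ξ, extension D T u (noiseMove a ξ z) ∂stepLaw d)
      (fun _ => u z.1 z.2) (Ioo 0 (alpha D z)) := fun a ha =>
    hu.mean_value_of_lt hd hDo hDb hz ha.1 ha.2
  exact heq.of_subset_closure hcont continuousOn_const Ioo_subset_Icc_self
    (by rw [closure_Ioo hpos.ne]) (right_mem_Icc.2 hpos.le)

/-! ### The stopped walk -/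

theorem exp_neg_le_one_sub_half {r : ℝ} (hr : r ∈ Icc (0 : ℝ) 1) : Real.exp (-r) ≤ 1 - r / 2 := by
  have h1 := Real.add_one_le_exp r
  have h2 : Real.exp (-r) * Real.exp r = 1 := by rw [← Real.exp_add]; simp
  have h3 := Real.exp_pos (-r)
  by_contra hlt
  rw [not_le] at hlt
  nlinarith [hr.1, hr.2, mul_nonneg hr.1 (sub_nonneg.2 hr.2)]

theorem integrable_comp_radial {d : ℕ} {g : ℝ → ℝ} (hg : Continuous g) :
    Integrable (fun p => g (radial d p.1 p.2)) (radialNoise d) := by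
  obtain ⟨M, hM⟩ := isCompact_Icc.exists_bound_of_continuousOn (hg.continuousOn (s := Icc 0 1))
  exact Integrable.of_bound (hg.measurable.comp (measurable_radial d)).aestronglyMeasurable M
    ((ae_radial_mem_Icc d).mono fun p hp => hM _ hp)

theorem integral_exp_neg_radial_lt_one {d : ℕ} (hd : 1 ≤ d) :
    ∫ p, Real.exp (-radial d p.1 p.2) ∂radialNoise d < 1 := by
  have h1 : ∫ p, Real.exp (-radial d p.1 p.2) ∂radialNoise d ≤
      ∫ p, (1 - radial d p.1 p.2 / 2) ∂radialNoise d :=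
    integral_mono_ae (integrable_comp_radial (g := fun r => Real.exp (-r)) (by fun_prop))
      (integrable_comp_radial (g := fun r => 1 - r / 2) (by fun_prop))
      ((ae_radial_mem_Icc d).mono fun p hp => exp_neg_le_one_sub_half hp)
  have h2 : ∫ p, (1 - radial d p.1 p.2 / 2) ∂radialNoise d =
      1 - (∫ p, radial d p.1 p.2 ∂radialNoise d) / 2 := by
    rw [integral_sub (integrable_const _)
      (integrable_comp_radial (g := fun r => r / 2) (by fun_prop)), integral_div]
    simp
  have h3 := integral_radial_pow hd 1
  simp only [pow_one] at h3
  have h4 : 0 < ∫ p, radial d p.1 p.2 ∂radialNoise d := by rw [h3]; positivity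
  linarith

/-- Independent variables with values in `[0,1]` and with a common value `q < 1` of `E exp (-X)`
have unbounded sums, by Chernoff's bound. -/
theorem ae_exists_lt_sum {Ω : Type v} [MeasurableSpace Ω] {P : Measure Ω} [IsProbabilityMeasure P]
    {X : ℕ → Ω → ℝ} (hXm : ∀ n, Measurable (X n)) (hXi : iIndepFun X P)
    (hX01 : ∀ᵐ ω ∂P, ∀ n, X n ω ∈ Icc (0 : ℝ) 1) {q : ℝ} (hq0 : 0 ≤ q) (hq1 : q < 1)
    (hmgf : ∀ n, mgf (X n) P (-1) = q) (C : ℝ) :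
    ∀ᵐ ω ∂P, ∃ n, C < ∑ k ∈ Finset.range n, X k ω := by
  have hbound : ∀ n, P.real {ω | (∑ k ∈ Finset.range n, X k) ω ≤ C} ≤ Real.exp C * q ^ n := by
    intro n
    have hSm : Measurable (∑ k ∈ Finset.range n, X k) := by fun_prop
    have h1 := measure_le_le_exp_mul_mgf (μ := P) (X := ∑ k ∈ Finset.range n, X k) (t := -1) C
      (by norm_num) ?_
    · rw [hXi.mgf_sum hXm] at h1
      simpa only [hmgf, Finset.prod_const, Finset.card_range, neg_neg, one_mul] using h1
    · refine Integrable.of_bound (hSm.const_mul (-1)).exp.aestronglyMeasurable 1 ?_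
      filter_upwards [hX01] with ω hω
      rw [Real.norm_eq_abs, abs_of_pos (Real.exp_pos _), Real.exp_le_one_iff, Finset.sum_apply]
      have := Finset.sum_nonneg fun k (_ : k ∈ Finset.range n) => (hω k).1
      linarith
  have hnull : P {ω | ∀ n, (∑ k ∈ Finset.range n, X k) ω ≤ C} = 0 := by
    have hmono : ∀ n, P.real {ω | ∀ n, (∑ k ∈ Finset.range n, X k) ω ≤ C} ≤
        P.real {ω | (∑ k ∈ Finset.range n, X k) ω ≤ C} := fun n =>
      measureReal_mono (fun ω hω => hω n) (measure_ne_top P _)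
    rw [← measureReal_eq_zero_iff]
    refine le_antisymm (ge_of_tendsto' (f := fun n : ℕ => Real.exp C * q ^ n) (x := atTop) ?_
      fun n => (hmono n).trans (hbound n)) measureReal_nonneg
    simpa using (tendsto_pow_atTop_nhds_zero_of_lt_one hq0 hq1).const_mul (Real.exp C)
  rw [ae_iff]
  simpa only [not_exists, not_lt, Finset.sum_apply] using hnull

/-- The variables `((U n, G n), V n)` as one random variable. -/
def noise {Ω : Type v} {d : ℕ} (U : ℕ → Ω → Fin (d / 2 + 1) → ℝ) (G : ℕ → Ω → ℝ)
    (V : ℕ → Ω → Metric.sphere (0 : Space d) 1) (n : ℕ) (ω : Ω) : StepNoise d :=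
  ((U n ω, G n ω), V n ω)

section Noise

variable {Ω : Type v} [MeasurableSpace Ω] {P : Measure Ω} {d : ℕ}
  {U : ℕ → Ω → Fin (d / 2 + 1) → ℝ} {G : ℕ → Ω → ℝ} {V : ℕ → Ω → Metric.sphere (0 : Space d) 1}

theorem IsNoise.measurable_noise (h : IsNoise P U G V) (n : ℕ) : Measurable (noise U G V n) :=
  ((h.measurable_U n).prodMk (h.measurable_G n)).prodMk (h.measurable_V n)

theorem IsNoise.map_noise [IsProbabilityMeasure P] (hd : 1 ≤ d) (h : IsNoise P U G V) (n : ℕ) :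
    P.map (noise U G V n) = stepLaw d := by
  have := isProbabilityMeasure_uniformSphere hd
  have hU := h.measurable_U n
  have hG := h.measurable_G n
  have hV := h.measurable_V n
  have h1 := (h.indep_U_GV n).map_prod_eq_prod_map_map hU.aemeasurable (hG.prodMk hV).aemeasurable
  have h2 := (h.indep_G_V n).map_prod_eq_prod_map_map hG.aemeasurable hV.aemeasurable
  rw [h2, h.law_U, h.law_G, h.law_V, ← Measure.prodAssoc_prod] at h1
  refine MeasurableEquiv.prodAssoc.map_measurableEquiv_injective ?_
  rw [stepLaw, radialNoise, ← h1, Measure.map_map MeasurableEquiv.prodAssoc.measurable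
    (h.measurable_noise n)]
  rfl

theorem IsNoise.iIndepFun_noise (h : IsNoise P U G V) : iIndepFun (noise U G V) P :=
  h.indep_steps.comp (fun _ p => ((p.1, p.2.1), p.2.2)) fun _ => by fun_prop

theorem IsNoise.ae_radial_mem [IsProbabilityMeasure P] (hd : 1 ≤ d) (h : IsNoise P U G V) :
    ∀ᵐ ω ∂P, ∀ n, radial d (U n ω) (G n ω) ∈ Icc (0 : ℝ) 1 := by
  rw [ae_all_iff]
  intro n
  have := ae_stepLaw_radial_mem hd
  rw [← h.map_noise hd n] at this
  exact ae_of_ae_map (h.measurable_noise n).aemeasurable this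

theorem IsNoise.comap_le (h : IsNoise P U G V) (n : ℕ) :
    MeasurableSpace.comap (noise U G V n) inferInstance ≤ ‹MeasurableSpace Ω› :=
  (h.measurable_noise n).comap_le

end Noise

section Stopped

variable {d : ℕ} {D : Set (Space d)} {ε : ℝ}

/-- One step of the walk which does not move any more once `α ≤ ε`. -/
def stoppedStep (D : Set (Space d)) (ε : ℝ) (p : (ℝ × Space d) × StepNoise d) : ℝ × Space d :=
  if alpha D p.1 ≤ ε then p.1 else noiseMove (alpha D p.1) p.2 p.1

/-- The walk frozen as soon as `α ≤ ε`. -/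
def stoppedPath (D : Set (Space d)) (ε : ℝ) (ξ : ℕ → StepNoise d) (z : ℝ × Space d) :
    ℕ → ℝ × Space d
  | 0 => z
  | n + 1 => stoppedStep D ε (stoppedPath D ε ξ z n, ξ n)

theorem measurable_alpha (D : Set (Space d)) : Measurable (alpha D) := by
  have : Continuous fun z : ℝ × Space d => bdist D z.2 :=
    (Metric.continuous_infDist_pt _).comp continuous_snd
  unfold alpha
  exact Continuous.measurable (by fun_prop)

theorem measurable_stoppedStep (D : Set (Space d)) (ε : ℝ) : Measurable (stoppedStep D ε) := by
  have hα : Measurable fun p : (ℝ × Space d) × StepNoise d => alpha D p.1 :=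
    (measurable_alpha D).comp measurable_fst
  exact Measurable.ite (measurableSet_le hα measurable_const) measurable_fst
    ((measurable_noiseMove d).comp ((hα.prodMk measurable_fst).prodMk measurable_snd))

theorem stoppedStep_mem (hd : 1 ≤ d) (hDo : IsOpen D) {T : ℝ} {z : ℝ × Space d}
    (hz : z ∈ Icc 0 T ×ˢ closure D) {ξ : StepNoise d}
    (hξ : radial d ξ.1.1 ξ.1.2 ∈ Icc (0 : ℝ) 1) :
    stoppedStep D ε (z, ξ) ∈ Icc 0 T ×ˢ closure D := by
  unfold stoppedStep
  split_ifs
  · exact hz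
  · exact move_mem hd hDo hz (alpha_nonneg D hz.1.1) le_rfl hξ (mem_sphere_zero_iff_norm.1 ξ.2.2)

variable {Ω : Type v} {U : ℕ → Ω → Fin (d / 2 + 1) → ℝ} {G : ℕ → Ω → ℝ}
  {V : ℕ → Ω → Metric.sphere (0 : Space d) 1} {t : ℝ} {x : Space d} {ω : Ω}

theorem walk_succ (n : ℕ) : walk D U G V t x (n + 1) ω =
    noiseMove (alpha D (walk D U G V t x n ω)) (noise U G V n ω) (walk D U G V t x n ω) := rfl

theorem stoppedPath_eq_walk {n : ℕ} (hn : n ≤ stopIndex D U G V ε t x ω) :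
    stoppedPath D ε (fun k => noise U G V k ω) (t, x) n = walk D U G V t x n ω := by
  induction n with
  | zero => rfl
  | succ n ih =>
    have h : ¬ alpha D (walk D U G V t x n ω) ≤ ε := Nat.notMem_of_lt_sInf (m := n) hn
    rw [stoppedPath, ih (by omega), stoppedStep, if_neg h, walk_succ]

theorem stoppedPath_eq_stopped (h : ∃ n, alpha D (walk D U G V t x n ω) ≤ ε) {n : ℕ}
    (hn : stopIndex D U G V ε t x ω ≤ n) :
    stoppedPath D ε (fun k => noise U G V k ω) (t, x) n = stopped D U G V ε t x ω := by
  induction n, hn using Nat.le_induction with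
  | base => exact stoppedPath_eq_walk le_rfl
  | succ n _ ih =>
    have h' : alpha D (stopped D U G V ε t x ω) ≤ ε := Nat.sInf_mem h
    rw [stoppedPath, ih, stoppedStep, if_pos h']

theorem alpha_stopped_le (h : ∃ n, alpha D (walk D U G V t x n ω) ≤ ε) :
    alpha D (stopped D U G V ε t x ω) ≤ ε := Nat.sInf_mem h

theorem stoppedPath_mem (hd : 1 ≤ d) (hDo : IsOpen D) {T : ℝ} {z : ℝ × Space d}
    (hz : z ∈ Icc 0 T ×ˢ closure D) {ξ : ℕ → StepNoise d}
    (hξ : ∀ n, radial d (ξ n).1.1 (ξ n).1.2 ∈ Icc (0 : ℝ) 1) (n : ℕ) :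
    stoppedPath D ε ξ z n ∈ Icc 0 T ×ˢ closure D := by
  induction n with
  | zero => exact hz
  | succ n ih => exact stoppedStep_mem hd hDo ih (hξ n)

theorem walk_mem (hd : 1 ≤ d) (hDo : IsOpen D) {T : ℝ} (ht : t ∈ Icc 0 T) (hx : x ∈ closure D)
    (hR : ∀ n, radial d (U n ω) (G n ω) ∈ Icc (0 : ℝ) 1) (n : ℕ) :
    walk D U G V t x n ω ∈ Icc 0 T ×ˢ closure D := by
  induction n with
  | zero => exact ⟨ht, hx⟩
  | succ n ih =>
    rw [walk_succ]
    exact move_mem hd hDo ih (alpha_nonneg D ih.1.1) le_rfl (hR n)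
      (mem_sphere_zero_iff_norm.1 (V n ω).2)

/-- A walk that never stops uses up time at least `ε R_n` at each step. -/
theorem mul_sum_radial_le (hd : 1 ≤ d) (hDo : IsOpen D) {T : ℝ} (ht : t ∈ Icc 0 T)
    (hx : x ∈ closure D) (hR : ∀ n, radial d (U n ω) (G n ω) ∈ Icc (0 : ℝ) 1)
    (h : ∀ n, ε < alpha D (walk D U G V t x n ω)) (n : ℕ) :
    ε * ∑ k ∈ Finset.range n, radial d (U k ω) (G k ω) ≤ T := by
  have key : (walk D U G V t x n ω).1 ≤ t - ε * ∑ k ∈ Finset.range n, radial d (U k ω) (G k ω) := by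
    induction n with
    | zero => simp [walk, path]
    | succ n ih =>
      rw [walk_succ, Finset.sum_range_succ]
      simp only [noiseMove, move, noise]
      have := mul_le_mul_of_nonneg_right (h n).le (hR n).1
      linarith
  have := (walk_mem (V := V) hd hDo ht hx hR n).1.1
  linarith [ht.2]

/-- The frozen walk at index `n` is a function of the first `n` noise variables. -/
theorem measurable_stoppedPath (D : Set (Space d)) (ε : ℝ) (z : ℝ × Space d) (n : ℕ) :
    Measurable[⨆ k ∈ Iio n, MeasurableSpace.comap (noise U G V k) inferInstance]
      (fun ω => stoppedPath D ε (fun k => noise U G V k ω) z n) := by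
  induction n with
  | zero => exact measurable_const
  | succ n ih =>
    have h1 : (⨆ k ∈ Iio n, MeasurableSpace.comap (noise U G V k) inferInstance) ≤
        ⨆ k ∈ Iio (n + 1), MeasurableSpace.comap (noise U G V k) inferInstance :=
      biSup_mono fun k hk => lt_trans hk (Nat.lt_succ_self n)
    have h2 : MeasurableSpace.comap (noise U G V n) inferInstance ≤
        ⨆ k ∈ Iio (n + 1), MeasurableSpace.comap (noise U G V k) inferInstance :=
      le_biSup (fun k => MeasurableSpace.comap (noise U G V k) inferInstance)
        (show n ∈ Iio (n + 1) from Nat.lt_succ_self n)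
    exact (measurable_stoppedStep D ε).comp
      ((ih.mono h1 le_rfl).prodMk ((comap_measurable _).mono h2 le_rfl))

end Stopped

section Independence

variable {Ω : Type v} [MeasurableSpace Ω] {P : Measure Ω} {d : ℕ}
  {U : ℕ → Ω → Fin (d / 2 + 1) → ℝ} {G : ℕ → Ω → ℝ} {V : ℕ → Ω → Metric.sphere (0 : Space d) 1}

theorem IsNoise.measurable_stoppedPath (h : IsNoise P U G V) (D : Set (Space d)) (ε : ℝ)
    (z : ℝ × Space d) (n : ℕ) :
    Measurable fun ω => stoppedPath D ε (fun k => noise U G V k ω) z n :=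
  (HeatWalk.measurable_stoppedPath D ε z n).mono (iSup₂_le fun k _ => h.comap_le k) le_rfl

theorem IsNoise.indepFun_stoppedPath (h : IsNoise P U G V) (D : Set (Space d)) (ε : ℝ)
    (z : ℝ × Space d) (n : ℕ) :
    IndepFun (fun ω => stoppedPath D ε (fun k => noise U G V k ω) z n) (noise U G V n) P := by
  have h1 := indep_iSup_of_disjoint h.comap_le h.iIndepFun_noise.iIndep
    (S := Iio n) (T := {n}) (by simp)
  have h2 : MeasurableSpace.comap (noise U G V n) inferInstance ≤
      ⨆ k ∈ ({n} : Set ℕ), MeasurableSpace.comap (noise U G V k) inferInstance :=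
    le_biSup (fun k => MeasurableSpace.comap (noise U G V k) inferInstance) (mem_singleton n)
  have h3 := (HeatWalk.measurable_stoppedPath (U := U) (G := G) (V := V) D ε z n).comap_le
  rw [IndepFun_iff_Indep]
  exact indep_of_indep_of_le_left (indep_of_indep_of_le_right h1 h2) h3

end Independence

section Probability

variable {Ω : Type v} [MeasurableSpace Ω] {P : Measure Ω} [IsProbabilityMeasure P] {d : ℕ}
  {U : ℕ → Ω → Fin (d / 2 + 1) → ℝ} {G : ℕ → Ω → ℝ} {V : ℕ → Ω → Metric.sphere (0 : Space d) 1}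

theorem IsNoise.integral_radial (hd : 1 ≤ d) (h : IsNoise P U G V) (n : ℕ) (g : ℝ → ℝ)
    (hg : Measurable g) :
    ∫ ω, g (radial d (U n ω) (G n ω)) ∂P = ∫ p, g (radial d p.1 p.2) ∂radialNoise d := by
  have := isProbabilityMeasure_uniformSphere hd
  have hm : Measurable fun ξ : StepNoise d => g (radial d ξ.1.1 ξ.1.2) :=
    hg.comp ((measurable_radial d).comp measurable_fst)
  have h1 := integral_map (μ := P) (h.measurable_noise n).aemeasurable
    (f := fun ξ : StepNoise d => g (radial d ξ.1.1 ξ.1.2)) hm.aestronglyMeasurable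
  have h2 := integral_fun_fst (μ := radialNoise d) (ν := uniformSphere d)
    (fun p => g (radial d p.1 p.2))
  rw [probReal_univ, one_smul] at h2
  rw [h.map_noise hd n] at h1
  exact h1.symm.trans h2

theorem measurable_radial_comp {α : Type*} [MeasurableSpace α] {u : α → Fin (d / 2 + 1) → ℝ}
    {g : α → ℝ} (hu : Measurable u) (hg : Measurable g) :
    Measurable fun ω => radial d (u ω) (g ω) := by
  unfold radial
  have : ∀ i, Measurable fun ω => u ω i := fun i => (measurable_pi_apply i).comp hu
  fun_prop

theorem IsNoise.ae_exists_sum_gt (hd : 1 ≤ d) (h : IsNoise P U G V) (C : ℝ) :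
    ∀ᵐ ω ∂P, ∃ n, C < ∑ k ∈ Finset.range n, radial d (U k ω) (G k ω) := by
  have hr : Measurable fun ξ : StepNoise d => radial d ξ.1.1 ξ.1.2 :=
    (measurable_radial d).comp measurable_fst
  have hXm : ∀ n, Measurable fun ω => radial d (U n ω) (G n ω) := fun n =>
    measurable_radial_comp (h.measurable_U n) (h.measurable_G n)
  have hXi : iIndepFun (fun n ω => radial d (U n ω) (G n ω)) P :=
    h.iIndepFun_noise.comp (fun _ ξ => radial d ξ.1.1 ξ.1.2) fun _ => hr
  have hmgf : ∀ n, mgf (fun ω => radial d (U n ω) (G n ω)) P (-1) =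
      ∫ p, Real.exp (-radial d p.1 p.2) ∂radialNoise d := by
    intro n
    rw [mgf, ← h.integral_radial hd n (fun r => Real.exp (-r)) (by fun_prop)]
    simp only [neg_one_mul]
  have hq0 : 0 ≤ ∫ p, Real.exp (-radial d p.1 p.2) ∂radialNoise d :=
    integral_nonneg fun _ => (Real.exp_pos _).le
  exact ae_exists_lt_sum hXm hXi (h.ae_radial_mem hd) hq0 (integral_exp_neg_radial_lt_one hd)
    hmgf C

theorem IsNoise.ae_exists_alpha_le (hd : 1 ≤ d) {D : Set (Space d)} (hDo : IsOpen D)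
    (h : IsNoise P U G V) {T t ε : ℝ} {x : Space d} (hε : 0 < ε) (ht : t ∈ Icc 0 T)
    (hx : x ∈ closure D) : ∀ᵐ ω ∂P, ∃ n, alpha D (walk D U G V t x n ω) ≤ ε := by
  filter_upwards [h.ae_exists_sum_gt hd (T / ε), h.ae_radial_mem hd] with ω ⟨n, hn⟩ hR
  by_contra! hlt
  have := mul_sum_radial_le hd hDo ht hx hR hlt n
  rw [div_lt_iff₀' hε] at hn
  linarith

end Probability

section OptionalStopping

variable {Ω : Type v} [MeasurableSpace Ω] {P : Measure Ω} [IsProbabilityMeasure P] {d : ℕ}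
  {D : Set (Space d)} {T : ℝ} {f : ℝ → Space d → ℝ} {f₀ : Space d → ℝ} {u : ℝ → Space d → ℝ}
  {U : ℕ → Ω → Fin (d / 2 + 1) → ℝ} {G : ℕ → Ω → ℝ} {V : ℕ → Ω → Metric.sphere (0 : Space d) 1}

/-- The values of a solution along the frozen walk form a martingale; only their constant
expectation is needed. -/
theorem IsSolution.integral_stoppedPath (hd : 1 ≤ d) (hDo : IsOpen D)
    (hDb : Bornology.IsBounded D) (hu : IsSolution D T f f₀ u) (h : IsNoise P U G V) (ε : ℝ)
    {z : ℝ × Space d} (hz : z ∈ Icc 0 T ×ˢ closure D) (n : ℕ) :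
    ∫ ω, extension D T u (stoppedPath D ε (fun k => noise U G V k ω) z n) ∂P = u z.1 z.2 := by
  have := isProbabilityMeasure_stepLaw hd
  have hw := measurable_extension hu.continuous_closure
  obtain ⟨M, hM⟩ := exists_bound_extension hDb hu.continuous_closure
  induction n with
  | zero => simp [stoppedPath, extension_of_mem u hz]
  | succ n ih =>
    rw [← ih]
    set Z : Ω → ℝ × Space d := fun ω => stoppedPath D ε (fun k => noise U G V k ω) z n with hZ
    have hZm : Measurable Z := h.measurable_stoppedPath D ε z n
    have hξm := h.measurable_noise n
    have hZmem : ∀ᵐ ω ∂P, Z ω ∈ Icc 0 T ×ˢ closure D := by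
      filter_upwards [h.ae_radial_mem hd] with ω hω
      exact stoppedPath_mem hd hDo hz hω n
    have hlaw := (h.indepFun_stoppedPath D ε z n).map_prod_eq_prod_map_map hZm.aemeasurable
      hξm.aemeasurable
    rw [h.map_noise hd n] at hlaw
    have hgm : Measurable fun p : (ℝ × Space d) × StepNoise d =>
        extension D T u (stoppedStep D ε p) := hw.comp (measurable_stoppedStep D ε)
    have : IsProbabilityMeasure (P.map Z) := Measure.isProbabilityMeasure_map hZm.aemeasurable
    have e1 : ∫ ω, extension D T u (stoppedPath D ε (fun k => noise U G V k ω) z (n + 1)) ∂P =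
        ∫ p, extension D T u (stoppedStep D ε p) ∂((P.map Z).prod (stepLaw d)) := by
      rw [← hlaw]
      exact (integral_map (hZm.prodMk hξm).aemeasurable hgm.aestronglyMeasurable).symm
    rw [e1, integral_prod _ (Integrable.of_bound hgm.aestronglyMeasurable M
      (ae_of_all _ fun p => hM _)), integral_map hZm.aemeasurable]
    · refine integral_congr_ae ?_
      filter_upwards [hZmem] with ω hω
      by_cases hα : alpha D (Z ω) ≤ ε
      · simp only [stoppedStep, hα, if_true, integral_const, probReal_univ, one_smul]
        rfl
      · simp only [stoppedStep, hα, if_false]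
        exact hu.mean_value hd hDo hDb hω
    · exact hgm.stronglyMeasurable.integral_prod_right'.aestronglyMeasurable

theorem IsNoise.ae_tendsto_stopped (hd : 1 ≤ d) (hDo : IsOpen D) (h : IsNoise P U G V)
    {ε t : ℝ} {x : Space d} (hε : 0 < ε) (ht : t ∈ Icc 0 T) (hx : x ∈ closure D) :
    ∀ᵐ ω ∂P, ∀ᶠ n in atTop, stoppedPath D ε (fun k => noise U G V k ω) (t, x) n =
      stopped D U G V ε t x ω := by
  filter_upwards [h.ae_exists_alpha_le hd hDo hε ht hx] with ω hω
  exact eventually_atTop.2 ⟨_, fun n hn => stoppedPath_eq_stopped hω hn⟩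

theorem IsNoise.aemeasurable_stopped (hd : 1 ≤ d) (hDo : IsOpen D) (h : IsNoise P U G V)
    {ε t : ℝ} {x : Space d} (hε : 0 < ε) (ht : t ∈ Icc 0 T) (hx : x ∈ closure D) :
    AEMeasurable (stopped D U G V ε t x) P := by
  refine aemeasurable_of_tendsto_metrizable_ae atTop
    (fun n => (h.measurable_stoppedPath D ε (t, x) n).aemeasurable) ?_
  filter_upwards [h.ae_tendsto_stopped hd hDo hε ht hx] with ω hω
  exact tendsto_nhds_of_eventually_eq hω

/-- Optional stopping: the walk is almost surely stopped, and the expectation of the solution at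
the place where it stops is the value at the starting point. -/
theorem IsSolution.integral_stopped (hd : 1 ≤ d) (hDo : IsOpen D)
    (hDb : Bornology.IsBounded D) (hu : IsSolution D T f f₀ u) (h : IsNoise P U G V)
    {ε t : ℝ} {x : Space d} (hε : 0 < ε) (ht : t ∈ Icc 0 T) (hx : x ∈ closure D) :
    ∫ ω, extension D T u (stopped D U G V ε t x ω) ∂P = u t x := by
  have hw := measurable_extension hu.continuous_closure
  obtain ⟨M, hM⟩ := exists_bound_extension hDb hu.continuous_closure
  have hlim := tendsto_integral_of_dominated_convergence (μ := P)
    (F := fun n ω => extension D T u (stoppedPath D ε (fun k => noise U G V k ω) (t, x) n))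
    (f := fun ω => extension D T u (stopped D U G V ε t x ω)) (fun _ => M)
    (fun n => (hw.comp (h.measurable_stoppedPath D ε (t, x) n)).aestronglyMeasurable)
    (integrable_const M) (fun n => ae_of_all _ fun ω => hM _) ?_
  · refine tendsto_nhds_unique hlim ?_
    have : ∀ n, ∫ ω, extension D T u (stoppedPath D ε (fun k => noise U G V k ω) (t, x) n) ∂P =
        u t x := fun n => hu.integral_stoppedPath hd hDo hDb h ε ⟨ht, hx⟩ n
    simp only [this]
    exact tendsto_const_nhds
  · filter_upwards [h.ae_tendsto_stopped hd hDo hε ht hx] with ω hω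
    exact tendsto_nhds_of_eventually_eq (hω.mono fun n hn => by simp only [hn])

theorem IsNoise.ae_stopped (hd : 1 ≤ d) (hDo : IsOpen D) (h : IsNoise P U G V)
    {ε t : ℝ} {x : Space d} (hε : 0 < ε) (ht : t ∈ Icc 0 T) (hx : x ∈ closure D) :
    ∀ᵐ ω ∂P, stopped D U G V ε t x ω ∈ Icc 0 T ×ˢ closure D ∧
      alpha D (stopped D U G V ε t x ω) ≤ ε := by
  filter_upwards [h.ae_exists_alpha_le hd hDo hε ht hx, h.ae_radial_mem hd] with ω hω hR
  exact ⟨walk_mem hd hDo ht hx hR _, alpha_stopped_le hω⟩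

end OptionalStopping

/-! ### The error made at the stop -/

section Error

variable {d : ℕ} {D : Set (Space d)} {T : ℝ} {f : ℝ → Space d → ℝ} {f₀ : Space d → ℝ}
  {u : ℝ → Space d → ℝ}

/-- A point at which `α ≤ ε` and which is not close to the boundary is close to time `0`. -/
theorem fst_le_of_alpha_le (hd : 1 ≤ d) {ε : ℝ} {z : ℝ × Space d} (h : alpha D z ≤ ε)
    (hfar : ¬ bdist D z.2 ^ 2 ≤ 2 * ε * d / Real.exp 1) : z.1 ≤ ε := by
  have hd0 : (0 : ℝ) < d := by exact_mod_cast hd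
  refine (min_le_iff.1 h).resolve_right fun h' => hfar ?_
  rw [le_div_iff₀ (Real.exp_pos 1)]
  rw [div_mul_eq_mul_div, div_le_iff₀ (by positivity)] at h'
  linarith

/-- The error of the approximation is at most the variation of the solution between the place
where the walk stops and the place where the data are read off. -/
theorem IsSolution.abs_sub_approx_le {Ω : Type v} [MeasurableSpace Ω] {P : Measure Ω}
    [IsProbabilityMeasure P] {U : ℕ → Ω → Fin (d / 2 + 1) → ℝ} {G : ℕ → Ω → ℝ}
    {V : ℕ → Ω → Metric.sphere (0 : Space d) 1} {Y : ℝ → ℝ → Space d → Ω → Space d}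
    (hd : 1 ≤ d) (hDo : IsOpen D) (hDb : Bornology.IsBounded D) (hu : IsSolution D T f f₀ u)
    (h : IsNoise P U G V) (hY : IsFinalPosition D U G V P T Y) {ε η : ℝ} (hε : 0 < ε)
    (hnear : ∀ s ∈ Icc 0 T, ∀ y ∈ closure D, ∀ y' ∈ frontier D, dist y y' = bdist D y →
      dist y y' ≤ √(2 * ε * d / Real.exp 1) → |u s y - u s y'| ≤ η)
    (hfar : ∀ s ∈ Icc 0 T, s ≤ ε → ∀ y ∈ D, |u s y - u 0 y| ≤ η)
    {t : ℝ} (ht : t ∈ Icc 0 T) {x : Space d} (hx : x ∈ closure D) :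
    |u t x - approx D U G V P Y f f₀ ε t x| ≤ η := by
  have h0T : (0 : ℝ) ∈ Icc 0 T := ⟨le_rfl, ht.1.trans ht.2⟩
  set S := stopped D U G V ε t x with hS
  set τ := finalTime D U G V ε t x with hτ
  set A : Set Ω := Y ε t x ⁻¹' frontier D with hA
  have hYm := hY.measurable ε hε t ht x hx
  have hAm : MeasurableSet A := hYm isClosed_frontier.measurableSet
  have hSm : AEMeasurable S P := h.aemeasurable_stopped hd hDo hε ht hx
  -- the alternatives for the stopped walk: data read off at `∂D`, or at time `0`
  have hcases : ∀ᵐ ω ∂P, S ω ∈ Icc 0 T ×ˢ closure D ∧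
      ((Y ε t x ω ∈ frontier D ∧ τ ω = (S ω).1 ∧ dist (S ω).2 (Y ε t x ω) = bdist D (S ω).2 ∧
        dist (S ω).2 (Y ε t x ω) ≤ √(2 * ε * d / Real.exp 1)) ∨
      (Y ε t x ω ∈ D ∧ τ ω = 0 ∧ Y ε t x ω = (S ω).2 ∧ (S ω).1 ≤ ε)) := by
    filter_upwards [h.ae_stopped hd hDo hε ht hx, hY.near ε hε t ht x hx,
      hY.far ε hε t ht x hx] with ω hω hn hf
    refine ⟨hω.1, ?_⟩
    by_cases hclose : StopsNearBoundary D U G V ε t x ω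
    · obtain ⟨h1, h2⟩ := hn hclose
      refine Or.inl ⟨h1, if_pos hclose, h2, h2.le.trans (Real.le_sqrt_of_sq_le hclose)⟩
    · have h1 := hf hclose
      have hpos : 0 < bdist D (S ω).2 := by
        refine Metric.infDist_nonneg.lt_of_ne' fun h0 => hclose ?_
        change bdist D (S ω).2 ^ 2 ≤ 2 * ε * d / Real.exp 1
        rw [bdist, h0, zero_pow two_ne_zero]
        positivity
      exact Or.inr ⟨h1 ▸ mem_of_bdist_pos hDo hω.1.2 hpos, if_neg hclose, h1,
        fst_le_of_alpha_le hd hω.2 hclose⟩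
  have hdisj : ∀ y ∈ D, y ∉ frontier D := fun y hy hyf => by
    rw [hDo.frontier_eq] at hyf
    exact hyf.2 hy
  -- the walk is close to the boundary exactly when its final position is on the boundary
  have hτm : AEMeasurable τ P := by
    refine (hSm.fst.indicator hAm).congr ?_
    filter_upwards [hcases] with ω ⟨_, hω⟩
    rcases hω with ⟨h1, h2, -⟩ | ⟨h1, h2, -⟩
    · rw [indicator_of_mem (show ω ∈ A from h1), h2]
    · rw [indicator_of_notMem (show ω ∉ A from hdisj _ h1), h2]
  have hw := measurable_extension hu.continuous_closure
  obtain ⟨M, hM⟩ := exists_bound_extension hDb hu.continuous_closure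
  have hFi : Integrable (fun ω => extension D T u (τ ω, Y ε t x ω)) P :=
    Integrable.of_bound (hw.comp_aemeasurable (hτm.prodMk hYm.aemeasurable)).aestronglyMeasurable
      M (ae_of_all _ fun _ => hM _)
  have hSi : Integrable (fun ω => extension D T u (S ω)) P :=
    Integrable.of_bound (hw.comp_aemeasurable hSm).aestronglyMeasurable M
      (ae_of_all _ fun _ => hM _)
  have happrox : approx D U G V P Y f f₀ ε t x =
      ∫ ω, extension D T u (τ ω, Y ε t x ω) ∂P := by
    rw [← integral_add_compl hAm hFi, ← integral_indicator hAm, ← integral_indicator hAm.compl,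
      approx]
    congr 1
    all_goals
      refine integral_congr_ae ?_
      filter_upwards [hcases] with ω ⟨hSω, hω⟩
      rcases hω with ⟨h1, h2, -⟩ | ⟨h1, h2, -⟩
    · rw [indicator_of_mem h1, indicator_of_mem (show ω ∈ A from h1),
        extension_of_mem u ⟨h2 ▸ hSω.1, frontier_subset_closure h1⟩,
        hu.boundary _ (h2 ▸ hSω.1) _ h1]
    · rw [indicator_of_notMem (hdisj _ h1),
        indicator_of_notMem (show ω ∉ A from hdisj _ h1)]
    · rw [indicator_of_notMem (show Y ε t x ω ∉ (frontier D)ᶜ from not_not.2 h1),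
        indicator_of_notMem (show ω ∉ Aᶜ from not_not.2 h1)]
    · rw [indicator_of_mem (show Y ε t x ω ∈ (frontier D)ᶜ from hdisj _ h1),
        indicator_of_mem (show ω ∈ Aᶜ from hdisj _ h1), h2,
        extension_of_mem u ⟨h0T, subset_closure h1⟩, hu.initial _ h1]
  rw [happrox, ← hu.integral_stopped hd hDo hDb h hε ht hx, ← integral_sub hSi hFi,
    ← Real.norm_eq_abs]
  refine (norm_integral_le_of_norm_le_const (C := η) ?_).trans (by simp)
  filter_upwards [hcases] with ω ⟨hSω, hω⟩
  rw [Real.norm_eq_abs]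
  rcases hω with ⟨h1, h2, h3, h4⟩ | ⟨h1, h2, h3, h4⟩
  · rw [extension_of_mem u hSω, h2,
      extension_of_mem u (z := ((S ω).1, Y ε t x ω)) ⟨hSω.1, frontier_subset_closure h1⟩]
    exact hnear _ hSω.1 _ hSω.2 _ h1 h3 h4
  · rw [extension_of_mem u hSω, h2,
      extension_of_mem u (z := (0, Y ε t x ω)) ⟨h0T, subset_closure h1⟩, h3]
    exact hfar _ hSω.1 h4 _ (h3 ▸ h1)

/-- Bounded space derivatives: a Lipschitz bound up to the nearest boundary points. -/
theorem IsSolution.abs_sub_le_mul_dist (hDo : IsOpen D) (hT : 0 < T) (hu : IsSolution D T f f₀ u)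
    {K : ℝ} (hK : ∀ t ∈ Ioo 0 T, ∀ x ∈ D, ‖fderiv ℝ (u t) x‖ ≤ K) {s : ℝ} (hs : s ∈ Icc 0 T)
    {y y' : Space d} (hy : y ∈ closure D) (hyy' : dist y y' = bdist D y) :
    |u s y - u s y'| ≤ K * dist y y' := by
  rcases Metric.infDist_nonneg.eq_or_lt' (a := bdist D y) with h0 | hpos
  · have : y = y' := dist_eq_zero.1 (hyy'.trans h0)
    simp [this]
  have hyD := mem_of_bdist_pos hDo hy hpos
  have hball := ball_bdist_subset hDo hyD
  have hcl : closure (Ioo 0 T ×ˢ Metric.ball y (bdist D y)) =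
      Icc 0 T ×ˢ Metric.closedBall y (bdist D y) := by
    rw [closure_prod_eq, closure_Ioo hT.ne, closure_ball y hpos.ne']
  refine le_on_closure (s := Ioo 0 T ×ˢ Metric.ball y (bdist D y))
    (f := fun p : ℝ × Space d => |u p.1 y - u p.1 p.2|) (g := fun p => K * dist y p.2)
    (fun p hp => ?_) ?_ (by fun_prop) (x := (s, y')) ?_
  · have hdiff : ∀ x ∈ Metric.ball y (bdist D y), DifferentiableAt ℝ (u p.1) x := fun x hx =>
      ((hu.isC12.contDiff_space _ hp.1).differentiableOn (by norm_num)).differentiableAt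
        (hDo.mem_nhds (hball hx))
    have := (convex_ball y (bdist D y)).norm_image_sub_le_of_norm_fderiv_le hdiff
      (fun x hx => hK _ hp.1 _ (hball hx)) hp.2 (Metric.mem_ball_self hpos)
    rwa [Real.norm_eq_abs, ← dist_eq_norm] at this
  · rw [hcl]
    have hsub := closedBall_bdist_subset hDo hyD hpos
    refine (ContinuousOn.sub ?_ ?_).abs
    · exact hu.continuous_closure.comp (f := fun p : ℝ × Space d => (p.1, y)) (by fun_prop)
        fun p hp => ⟨hp.1, hy⟩
    · exact hu.continuous_closure.mono (prod_mono_right hsub)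
  · rw [hcl]
    exact ⟨hs, by rw [Metric.mem_closedBall, dist_comm, hyy']⟩

/-- Bounded time derivative: a Lipschitz bound up to the ends of the time interval. -/
theorem IsSolution.abs_sub_le_mul_abs_sub (hT : 0 < T) (hu : IsSolution D T f f₀ u)
    {K : ℝ} (hK : ∀ t ∈ Ioo 0 T, ∀ x ∈ D, |deriv (fun s => u s x) t| ≤ K) {s s' : ℝ}
    (hs : s ∈ Icc 0 T) (hs' : s' ∈ Icc 0 T) {y : Space d} (hy : y ∈ D) :
    |u s y - u s' y| ≤ K * |s - s'| := by
  have hcl : closure (Ioo 0 T ×ˢ Ioo 0 T) = Icc 0 T ×ˢ Icc 0 T := by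
    rw [closure_prod_eq, closure_Ioo hT.ne]
  refine le_on_closure (s := Ioo 0 T ×ˢ Ioo 0 T) (f := fun p : ℝ × ℝ => |u p.1 y - u p.2 y|)
    (g := fun p => K * |p.1 - p.2|) (fun p hp => ?_) ?_ (by fun_prop) (x := (s, s'))
    (hcl ▸ ⟨hs, hs'⟩)
  · exact (convex_Ioo 0 T).norm_image_sub_le_of_norm_deriv_le
      (fun r hr => hu.isC12.differentiable_time r hr y hy) (fun r hr => hK r hr y hy) hp.2 hp.1
  · rw [hcl]
    refine (ContinuousOn.sub ?_ ?_).abs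
    · exact hu.continuous_closure.comp (f := fun p : ℝ × ℝ => (p.1, y)) (by fun_prop)
        fun p hp => ⟨hp.1, subset_closure hy⟩
    · exact hu.continuous_closure.comp (f := fun p : ℝ × ℝ => (p.2, y)) (by fun_prop)
        fun p hp => ⟨hp.2, subset_closure hy⟩

end Error

end HeatWalk

end

theorem mainTheorem4 {d : ℕ} (hd : 1 ≤ d) (D : Set (HeatWalk.Space d)) (hDo : IsOpen D)
    (hDc : IsConnected D) (hDb : Bornology.IsBounded D) (T : ℝ) (hT : 0 < T)
    (f : ℝ → HeatWalk.Space d → ℝ) (f₀ : HeatWalk.Space d → ℝ) (u : ℝ → HeatWalk.Space d → ℝ)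
    (hu : HeatWalk.IsSolution D T f f₀ u) :
    (∀ (Ω : Type v) [MeasurableSpace Ω] (P : Measure Ω) [IsProbabilityMeasure P]
        (U : ℕ → Ω → Fin (d / 2 + 1) → ℝ) (G : ℕ → Ω → ℝ)
        (V : ℕ → Ω → Metric.sphere (0 : HeatWalk.Space d) 1)
        (Y : ℝ → ℝ → HeatWalk.Space d → Ω → HeatWalk.Space d),
        HeatWalk.IsNoise P U G V → HeatWalk.IsFinalPosition D U G V P T Y →
        TendstoUniformlyOn
          (fun (ε : ℝ) (p : ℝ × HeatWalk.Space d) =>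
            HeatWalk.approx D U G V P Y f f₀ ε p.1 p.2)
          (fun p => u p.1 p.2) (𝓝[>] 0) (Icc 0 T ×ˢ closure D)) ∧
    (HeatWalk.BoundedFirstDerivatives D T u →
      ∃ κ > 0, ∃ ε₀ > 0,
        ∀ (Ω : Type v) [MeasurableSpace Ω] (P : Measure Ω) [IsProbabilityMeasure P]
          (U : ℕ → Ω → Fin (d / 2 + 1) → ℝ) (G : ℕ → Ω → ℝ)
          (V : ℕ → Ω → Metric.sphere (0 : HeatWalk.Space d) 1)
          (Y : ℝ → ℝ → HeatWalk.Space d → Ω → HeatWalk.Space d),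
          HeatWalk.IsNoise P U G V → HeatWalk.IsFinalPosition D U G V P T Y →
          ∀ ε ∈ Ioc 0 ε₀, ∀ t ∈ Icc 0 T, ∀ x ∈ closure D,
            |u t x - HeatWalk.approx D U G V P Y f f₀ ε t x| ≤ κ * Real.sqrt ε) := by
  constructor
  · intro Ω _ P _ U G V Y h hY
    rw [Metric.tendstoUniformlyOn_iff]
    intro η hη
    obtain ⟨δ, hδ, hδu⟩ := Metric.uniformContinuousOn_iff.1
      ((isCompact_Icc.prod hDb.isCompact_closure).uniformContinuousOn_of_continuous
        hu.continuous_closure) (η / 2) (half_pos hη)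
    have hlim : Tendsto (fun ε : ℝ => √(2 * ε * d / Real.exp 1)) (𝓝[>] 0) (𝓝 0) := by
      have : Continuous fun ε : ℝ => √(2 * ε * d / Real.exp 1) := by fun_prop
      simpa using (this.tendsto 0).mono_left nhdsWithin_le_nhds
    filter_upwards [self_mem_nhdsWithin, nhdsWithin_le_nhds (Iio_mem_nhds hδ),
      hlim.eventually (Iio_mem_nhds hδ)] with ε hε hε1 hε2 p hp
    refine lt_of_le_of_lt ?_ (half_lt_self hη)
    rw [Real.dist_eq]
    refine hu.abs_sub_approx_le hd hDo hDb h hY hε ?_ ?_ hp.1 hp.2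
    · intro s hs y hy y' hy' _ hle
      refine (hδu (s, y) ⟨hs, hy⟩ (s, y') ⟨hs, frontier_subset_closure hy'⟩ ?_).le
      rw [Prod.dist_eq, dist_self]
      exact max_lt hδ (hle.trans_lt hε2)
    · intro s hs hsε y hy
      refine (hδu (s, y) ⟨hs, subset_closure hy⟩ (0, y)
        ⟨⟨le_rfl, hT.le⟩, subset_closure hy⟩ ?_).le
      rw [Prod.dist_eq, dist_self, Real.dist_eq, sub_zero, abs_of_nonneg hs.1]
      exact max_lt (hsε.trans_lt hε1) hδ
  · rintro ⟨K₀, hK₀⟩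
    set K := max K₀ 0
    have hK0 : 0 ≤ K := le_max_right _ _
    -- `√(2 d / e) √ε` bounds the displacement if the walk stops close to `∂D`, and `ε ≤ √ε` bounds
    -- the change of time if it does not; the summand `1` makes the constant positive
    refine ⟨K * (√(2 * d / Real.exp 1) + 1) + 1, by positivity, 1, one_pos, ?_⟩
    intro Ω _ P _ U G V Y h hY ε hε t ht x hx
    have hsε : ε ≤ √ε := Real.le_sqrt_of_sq_le (by nlinarith [hε.1, hε.2])
    have hsq : √(2 * ε * d / Real.exp 1) = √(2 * d / Real.exp 1) * √ε := by
      rw [← Real.sqrt_mul' _ hε.1.le]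
      congr 1
      ring
    refine hu.abs_sub_approx_le hd hDo hDb h hY hε.1 ?_ ?_ ht hx
    · intro s hs y hy y' _ hyy' hle
      have h1 := hu.abs_sub_le_mul_dist hDo hT (K := K)
        (fun t ht x hx => (hK₀ t ht x hx).2.trans (le_max_left _ _)) hs hy hyy'
      calc |u s y - u s y'| ≤ K * dist y y' := h1
        _ ≤ K * (√(2 * d / Real.exp 1) * √ε) := by rw [← hsq]; gcongr
        _ ≤ (K * (√(2 * d / Real.exp 1) + 1) + 1) * √ε := by
          nlinarith [mul_nonneg hK0 (Real.sqrt_nonneg ε), Real.sqrt_nonneg ε]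
    · intro s hs hsε' y hy
      have h1 := hu.abs_sub_le_mul_abs_sub hT (K := K)
        (fun t ht x hx => (hK₀ t ht x hx).1.trans (le_max_left _ _)) hs ⟨le_rfl, hT.le⟩ hy
      rw [sub_zero, abs_of_nonneg hs.1] at h1
      calc |u s y - u 0 y| ≤ K * s := h1
        _ ≤ K * √ε := by gcongr; exact hsε'.trans hsε
        _ ≤ (K * (√(2 * d / Real.exp 1) + 1) + 1) * √ε := by
          nlinarith [mul_nonneg (mul_nonneg hK0 (Real.sqrt_nonneg (2 * d / Real.exp 1)))
            (Real.sqrt_nonneg ε), Real.sqrt_nonneg ε]
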